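/- For $x\in\mathbb R$ let $F$ be the Fresnel integral $$F(x)=\frac{e^{-i\pi/4}}{\sqrt\pi}\int_x^\infty e^{it^2}\,dt$$ (an improper integral). For an integer $N\ge 1$ let $A_N=\sqrt{(N+1/2)\pi}$, $t_k=(k-1/2)\pi/\sqrt{(N+1/2)\pi}$, and $$F_N(x)=\frac12+\frac i2\tan\!\left(A_Nxe^{i\pi/4}\right)+\frac{x}{A_N}e^{i(x^2+\pi/4)}\sum_{k=1}^N\frac{e^{-t_k^2}}{x^2+it_k^2}.$$ Let $\beta=1-\frac{\sqrt2}{2}-\frac{2\sqrt2+1}{16}$ and, for $x\in\mathbb R$, $$\eta_N(x)=\Delta_N(|x|)+\frac{(2\pi+1)|x|}{2\pi A_N\sqrt{x^4+A_N^4}}\,e^{-A_N^2},$$ where, for $x\ge 0$, $$\Delta_N(x)=\begin{cases}\dfrac{x\,e^{-A_N^2}}{\sqrt\pi\,(A_N^2-x^2/2)(1-e^{-2A_N^2})}, & 0\le \frac{x}{\sqrt2}\le\frac34A_N,\\[2ex] \dfrac{4x\,e^{-A_N^2}\left(1+2\sqrt\pi\,e^{-\beta A_N^2}\right)}{\sqrt\pi\,A_N(A_N+x/\sqrt2)(1-e^{-2A_N^2})},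 & \frac34A_N<\frac{x}{\sqrt2}<\frac54A_N,\\[2ex] \dfrac{x\,e^{-A_N^2}}{\sqrt\pi\,(x^2/2-A_N^2)(1-e^{-2A_N^2})}+\dfrac{e^{-\sqrt2A_Nx}}{1-e^{-\sqrt2A_Nx}}, & \frac{x}{\sqrt2}\ge\frac54A_N.\end{cases}$$ Let also $$c_N=\frac{20\sqrt2\,e^{-\pi/2}}{9\pi(1-e^{-2A_N^2})}\left(1+2\sqrt\pi\,e^{-\beta A_N^2}\right)+\frac{(2\pi+1)e^{-\pi/2}}{2\sqrt2\,\pi^{3/2}A_N},$$ $$c_N^*=\frac{10\sqrt2\,(4+5\sqrt{2\pi}A_N)(1+2\sqrt\pi\,e^{-\beta A_N^2})}{9\sqrt\pi\,e^{\pi/2}A_N(1-e^{-2A_N^2})}+\frac{2\pi+1}{\pi e^{\pi/2}A_N}\left(\frac{1}{\sqrt2A_N}+\sqrt\pi\right).$$ Theorem. The improper integral defining $F(x)$ converges and $F(x)\ne0$ for every $x\in\mathbb R$. For all integers $N\ge1$ and all $x\in\mathbb R$, $$\frac{|F(x)-F_N(x)|}{|F(x)|}\le\frac{\eta_N(x)}{|F(x)|}\le\begin{cases}c_N^*\,e^{-\pi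 N}, & x\ge0,\\[1ex] 2c_N\,\dfrac{e^{-\pi N}}{\sqrt{N+1/2}}, & x\le0.\end{cases}$$ Moreover $c_N^*$ is strictly decreasing in $N\ge1$, $c_1^*\approx10.4$ (that is, $|c_1^*-10.4|<0.05$), and $\lim_{N\to\infty}c_N^*=100e^{-\pi/2}/9\approx2.3$ (that is, $|100e^{-\pi/2}/9-2.3|<0.05$). -/

import Mathlib

open Filter Topology

noncomputable section

namespace FresnelTrap

/-- The truncated and normalised Fresnel integral
`(e^{-iπ/4} / √π) ∫_x^T e^{i t²} dt`. -/
def truncF (x T : ℝ) : ℂ :=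
  Complex.exp (-(Complex.I * (Real.pi / 4))) / (Real.sqrt Real.pi : ℂ) *
    ∫ t in x..T, Complex.exp (Complex.I * (t : ℂ) ^ 2)

/-- The Fresnel integral `F(x) = (e^{-iπ/4} / √π) ∫_x^∞ e^{i t²} dt`.  The integral converges only
conditionally, so it is the improper integral, the limit of the integrals over `[x, T]`. -/
def F (x : ℝ) : ℂ := limUnder atTop (fun T : ℝ => truncF x T)

/-- `A_N = √((N + 1/2) π)`. -/
def A (N : ℕ) : ℝ := Real.sqrt (((N : ℝ) + 1 / 2) * Real.pi)

/-- The quadrature nodes `t_k = (k - 1/2) π / √((N + 1/2) π)`. -/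
def node (N k : ℕ) : ℝ :=
  ((k : ℝ) - 1 / 2) * Real.pi / Real.sqrt (((N : ℝ) + 1 / 2) * Real.pi)

/-- The modified trapezium rule approximation
`F_N(x) = 1/2 + (i/2) tan(A_N x e^{iπ/4})
  + (x / A_N) e^{i(x² + π/4)} ∑_{k=1}^N e^{-t_k²} / (x² + i t_k²)`. -/
def approxF (N : ℕ) (x : ℝ) : ℂ :=
  1 / 2 + Complex.I / 2 *
      Complex.tan ((A N : ℂ) * (x : ℂ) * Complex.exp (Complex.I * (Real.pi / 4)))
    + (x : ℂ) / (A N : ℂ) * Complex.exp (Complex.I * ((x : ℂ) ^ 2 + Real.pi / 4)) *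
      ∑ k ∈ Finset.Icc 1 N,
        Complex.exp (-(node N k : ℂ) ^ 2) /
          ((x : ℂ) ^ 2 + Complex.I * (node N k : ℂ) ^ 2)

/-- `β = 1 - √2/2 - (2√2 + 1)/16`. -/
def β : ℝ := 1 - Real.sqrt 2 / 2 - (2 * Real.sqrt 2 + 1) / 16

/-- The piecewise bound `Δ_h(x)`, used for `x ≥ 0`, with `h = √(π / (N + 1/2))`, so that
`π / h = A_N`. -/
def Δ (N : ℕ) (x : ℝ) : ℝ :=
  if x / Real.sqrt 2 ≤ 3 / 4 * A N then
    x * Real.exp (-(A N) ^ 2) /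
      (Real.sqrt Real.pi * ((A N) ^ 2 - x ^ 2 / 2) * (1 - Real.exp (-2 * (A N) ^ 2)))
  else if x / Real.sqrt 2 < 5 / 4 * A N then
    4 * x * Real.exp (-(A N) ^ 2) *
        (1 + 2 * Real.sqrt Real.pi * Real.exp (-β * (A N) ^ 2)) /
      (Real.sqrt Real.pi * A N * (A N + x / Real.sqrt 2) * (1 - Real.exp (-2 * (A N) ^ 2)))
  else
    x * Real.exp (-(A N) ^ 2) /
        (Real.sqrt Real.pi * (x ^ 2 / 2 - (A N) ^ 2) * (1 - Real.exp (-2 * (A N) ^ 2)))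
      + Real.exp (-(Real.sqrt 2 * A N * x)) / (1 - Real.exp (-(Real.sqrt 2 * A N * x)))

/-- The pointwise error bound `η_N(x)`. -/
def η (N : ℕ) (x : ℝ) : ℝ :=
  Δ N |x| + (2 * Real.pi + 1) * |x| /
      (2 * Real.pi * A N * Real.sqrt (x ^ 4 + (A N) ^ 4)) * Real.exp (-(A N) ^ 2)

/-- The constant `c_N` of the absolute error bound. -/
def c (N : ℕ) : ℝ :=
  20 * Real.sqrt 2 * Real.exp (-(Real.pi / 2)) /
      (9 * Real.pi * (1 - Real.exp (-2 * (A N) ^ 2))) *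
      (1 + 2 * Real.sqrt Real.pi * Real.exp (-β * (A N) ^ 2))
    + (2 * Real.pi + 1) * Real.exp (-(Real.pi / 2)) /
      (2 * Real.sqrt 2 * Real.pi ^ (3 / 2 : ℝ) * A N)

/-- The constant `c_N^*` of the relative error bound. -/
def cStar (N : ℕ) : ℝ :=
  10 * Real.sqrt 2 * (4 + 5 * Real.sqrt (2 * Real.pi) * A N) *
      (1 + 2 * Real.sqrt Real.pi * Real.exp (-β * (A N) ^ 2)) /
      (9 * Real.sqrt Real.pi * Real.exp (Real.pi / 2) * A N *
        (1 - Real.exp (-2 * (A N) ^ 2)))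
    + (2 * Real.pi + 1) / (Real.pi * Real.exp (Real.pi / 2) * A N) *
      (1 / (Real.sqrt 2 * A N) + Real.sqrt Real.pi)

end FresnelTrap

end

/-!
# Error of the modified trapezium rule for the Fresnel integral

Put `p = e^{-iπ/4} x`, `a = Re p = x / √2` and `A = A_N`, and let
`K(q) = ∫_0^∞ e^{-q s - s² / 4} ds` (`gaussLaplace`).  The function `K` is entire, satisfies
`K' = 2 q K - 2` and the reflection formula `K(q) + K(-q) = 2 √π e^{q²}`, and the differential
equation gives `F(x) = e^{-p²} K(p) / (2 √π)` for all real `x` (`F_eq`).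

Each term of the quadrature sum is a Laplace transform, since
`p / (p² + t²) = ∫_0^∞ e^{-p s} cos(t s) ds`.  Poisson summation for the Gaussian under this
integral (`exists_hasSum_gaussian_image`) turns the sum over all nodes into the sum of
`(-1)ⁿ e^{-A² n²} K(p - A n)` over the integers.  The term `n = 0` is the Fresnel integral; by
reflection the tangent in `F_N` is exactly what makes the other terms small.  The
error before truncation is therefore
`(e^{-p²} / (2 √π)) ∑_{n ≥ 1} (-1)ⁿ e^{-A² n²} (K(A n - p) - K(A n + p))`
(`hasSum_error_of_reflection`), without any contour integration.

The three cases of `Δ` correspond to three estimates of this series.  For `a` well below `A`, write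
the difference of values of `K` as an integral of `sinh (p s)` and use
`|sinh ((1 - i) u)| ≤ √2 sinh u`.  For `a` near `A` only `n = 1` needs care:
`|K(q)| ≤ 2 / |q|` for `Re q ≥ 0`, and reflection covers `Re q < 0`.  For `a` well above `A`, use
the series before reflection, completing the square in each term, and bound the tangent separately.
The nodes left out by truncation are bounded by a geometric series.

The relative bounds rest on `|F(x)| ≥ 1 / 2` for `x ≤ 0`, which follows from `F(x) + F(-x) = 1`, and
on `|F(x)| ≥ 1 / (2 (1 + √π x))` for `x ≥ 0` (`le_norm_F`).  Let `e^{iπ/4} K(p) = g + i f`.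
For `x ≥ 11 / 10` the second bound follows from `f ≥ x³ / (x⁴ + 3 / 4)`, which is Jensen's inequality
in a representation of `f` as a Gaussian average.  For `x ≤ 11 / 10` it follows from
`f' = -2 x g`, `g' = 2 x f - 2`, which with `f ≥ 0` bound `f² + g²` below by an explicit
polynomial.
-/

namespace FresnelTrap

open MeasureTheory Set

/-! ### The Laplace transform of a Gaussian -/

/-- The Laplace transform `K(q) = ∫_0^∞ e^{-q s - s² / 4} ds` of a Gaussian, an entire function of `q`;
`K(q) = √π e^{q²} erfc q`. -/
noncomputable def gaussLaplace (q : ℂ) : ℂ :=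
  ∫ s in Ioi (0 : ℝ), Complex.exp (-q * s - (s : ℂ) ^ 2 / 4)

theorem integrable_exp_neg_mul_sub_sq (q : ℂ) :
    Integrable (fun s : ℝ => Complex.exp (-q * s - (s : ℂ) ^ 2 / 4)) := by
  have h := integrable_cexp_quadratic (b := 1 / 4) (by norm_num) (-q) 0
  refine h.congr (Eventually.of_forall fun s => ?_)
  dsimp only
  congr 1
  ring

theorem integral_exp_neg_mul_sub_sq (q : ℂ) :
    ∫ s : ℝ, Complex.exp (-q * s - (s : ℂ) ^ 2 / 4) =
      2 * (Real.sqrt Real.pi : ℂ) * Complex.exp (q ^ 2) := by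
  have h := integral_cexp_quadratic (b := -(1 / 4)) (by norm_num) (-q) 0
  have e : (Real.pi / -(-(1 / 4)) : ℂ) ^ (1 / 2 : ℂ) = 2 * (Real.sqrt Real.pi : ℂ) := by
    have : (Real.pi / -(-(1 / 4)) : ℂ) = ((4 * Real.pi : ℝ) : ℂ) := by push_cast; ring
    rw [this, show (1 / 2 : ℂ) = ((1 / 2 : ℝ) : ℂ) by push_cast; rfl,
      ← Complex.ofReal_cpow (by positivity), ← Real.sqrt_eq_rpow,
      show (4 : ℝ) * Real.pi = 2 ^ 2 * Real.pi by norm_num,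
      Real.sqrt_mul (by positivity), Real.sqrt_sq (by norm_num)]
    push_cast; rfl
  rw [e] at h
  rw [show q ^ 2 = 0 - (-q) ^ 2 / (4 * -(1 / 4)) by ring, ← h]
  congr 1
  ext s
  congr 1
  ring

/-- Reflection: the two half-line integrals add up to a full Gaussian integral. -/
theorem gaussLaplace_add_neg (q : ℂ) :
    gaussLaplace q + gaussLaplace (-q) =
      2 * (Real.sqrt Real.pi : ℂ) * Complex.exp (q ^ 2) := by
  have hint := integrable_exp_neg_mul_sub_sq q
  rw [← integral_exp_neg_mul_sub_sq, ← integral_add_compl measurableSet_Ioi hint, compl_Ioi]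
  congr 1
  have := integral_comp_neg_Iic (0 : ℝ)
    (fun s : ℝ => Complex.exp (-(-q) * s - (s : ℂ) ^ 2 / 4))
  rw [neg_zero] at this
  rw [gaussLaplace, ← this]
  congr 1
  ext s
  push_cast
  congr 1
  ring

theorem norm_exp_neg_mul_sub_sq (q : ℂ) (s : ℝ) :
    ‖Complex.exp (-q * s - (s : ℂ) ^ 2 / 4)‖ = Real.exp (-q.re * s - s ^ 2 / 4) := by
  rw [Complex.norm_exp]
  congr 1
  have : (-q * s - (s : ℂ) ^ 2 / 4) = -q * s - ((s ^ 2 / 4 : ℝ) : ℂ) := by push_cast; ring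
  rw [this, Complex.sub_re, Complex.ofReal_re, Complex.re_mul_ofReal, Complex.neg_re]

theorem integrableOn_exp_neg_mul {b : ℝ} (hb : 0 < b) :
    IntegrableOn (fun s : ℝ => Real.exp (-b * s)) (Ioi 0) := exp_neg_integrableOn_Ioi 0 hb

theorem integral_exp_neg_mul {b : ℝ} (hb : 0 < b) :
    ∫ s in Ioi (0 : ℝ), Real.exp (-b * s) = 1 / b := by
  rw [integral_exp_mul_Ioi (by linarith)]
  simp [neg_div_neg_eq]

/-- Completing the square: `-q s - s² / 4 ≤ -b s + (b - q)²` for real `q`.  The free parameter `b` is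
the decay rate to keep. -/
theorem integral_norm_exp_neg_mul_sub_sq_le (q : ℂ) {b : ℝ} (hb : 0 < b) :
    ∫ s in Ioi (0 : ℝ), ‖Complex.exp (-q * s - (s : ℂ) ^ 2 / 4)‖ ≤
      Real.exp ((b - q.re) ^ 2) / b := by
  have h : ∫ s in Ioi (0 : ℝ), Real.exp ((b - q.re) ^ 2) * Real.exp (-b * s) =
      Real.exp ((b - q.re) ^ 2) / b := by
    rw [integral_const_mul, integral_exp_neg_mul hb]; ring
  rw [← h]
  refine setIntegral_mono_on (integrable_exp_neg_mul_sub_sq q).norm.integrableOn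
    ((integrableOn_exp_neg_mul hb).const_mul _) measurableSet_Ioi fun s _ => ?_
  rw [norm_exp_neg_mul_sub_sq, ← Real.exp_add]
  apply Real.exp_le_exp.2
  nlinarith [sq_nonneg (s / 2 - (b - q.re))]

theorem norm_gaussLaplace_le (q : ℂ) {b : ℝ} (hb : 0 < b) :
    ‖gaussLaplace q‖ ≤ Real.exp ((b - q.re) ^ 2) / b :=
  (norm_integral_le_integral_norm _).trans (integral_norm_exp_neg_mul_sub_sq_le q hb)

theorem norm_gaussLaplace_le_one_div {q : ℂ} (hq : 0 < q.re) :
    ‖gaussLaplace q‖ ≤ 1 / q.re := by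
  simpa using norm_gaussLaplace_le q hq

theorem norm_gaussLaplace_le_sqrt_pi {q : ℂ} (hq : 0 ≤ q.re) :
    ‖gaussLaplace q‖ ≤ Real.sqrt Real.pi := by
  refine (norm_integral_le_integral_norm _).trans ?_
  have h := integral_gaussian_Ioi (1 / 4)
  have e : Real.sqrt (Real.pi / (1 / 4)) / 2 = Real.sqrt Real.pi := by
    rw [show Real.pi / (1 / 4) = 2 ^ 2 * Real.pi by ring, Real.sqrt_mul (by positivity),
      Real.sqrt_sq (by norm_num)]
    ring
  rw [← e, ← h]
  refine setIntegral_mono_on (integrable_exp_neg_mul_sub_sq q).norm.integrableOn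
    (integrable_exp_neg_mul_sq (by norm_num)).integrableOn measurableSet_Ioi fun s hs => ?_
  rw [norm_exp_neg_mul_sub_sq]
  apply Real.exp_le_exp.2
  have : 0 ≤ q.re * s := mul_nonneg hq (le_of_lt hs)
  linarith

theorem gaussLaplace_zero : gaussLaplace 0 = (Real.sqrt Real.pi : ℂ) := by
  have := gaussLaplace_add_neg 0
  simp only [neg_zero, ne_eq, OfNat.ofNat_ne_zero, not_false_eq_true, zero_pow, Complex.exp_zero,
    mul_one] at this
  linear_combination this / 2

theorem hasDerivAt_exp_neg_mul_sub_sq (q : ℂ) (s : ℝ) :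
    HasDerivAt (fun s : ℝ => Complex.exp (-q * s - (s : ℂ) ^ 2 / 4))
      ((-q - s / 2) * Complex.exp (-q * s - (s : ℂ) ^ 2 / 4)) s := by
  have h1 : HasDerivAt (fun s : ℂ => Complex.exp (-q * s - s ^ 2 / 4))
      ((-q - s / 2) * Complex.exp (-q * s - (s : ℂ) ^ 2 / 4)) (s : ℂ) := by
    have := (((hasDerivAt_id (s : ℂ)).const_mul (-q)).sub
      (((hasDerivAt_id (s : ℂ)).pow 2).div_const 4)).cexp
    refine this.congr_deriv ?_
    simp
    ring
  exact h1.comp_ofReal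

/-- The factor `s` costs a unit shift of the decay rate, since `s ≤ e^s`. -/
theorem norm_ofReal_mul_exp_le (q : ℂ) {s : ℝ} (hs : 0 ≤ s) :
    ‖(s : ℂ) * Complex.exp (-q * s - (s : ℂ) ^ 2 / 4)‖ ≤
      ‖Complex.exp (-(q - 1) * s - (s : ℂ) ^ 2 / 4)‖ := by
  rw [norm_mul, norm_exp_neg_mul_sub_sq, norm_exp_neg_mul_sub_sq, Complex.norm_real,
    Real.norm_of_nonneg hs]
  have h : s ≤ Real.exp s := by linarith [Real.add_one_le_exp s]
  calc s * Real.exp (-q.re * s - s ^ 2 / 4) ≤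
      Real.exp s * Real.exp (-q.re * s - s ^ 2 / 4) := by gcongr
    _ = _ := by
      rw [← Real.exp_add]; congr 1; simp; ring

theorem integrableOn_mul_exp (q : ℂ) :
    IntegrableOn (fun s : ℝ => (s : ℂ) * Complex.exp (-q * s - (s : ℂ) ^ 2 / 4)) (Ioi 0) := by
  refine (integrable_exp_neg_mul_sub_sq (q - 1)).norm.integrableOn.mono' ?_ ?_
  · exact Continuous.aestronglyMeasurable (by fun_prop)
  · exact (ae_restrict_iff' measurableSet_Ioi).2
      (Eventually.of_forall fun s hs => norm_ofReal_mul_exp_le q (le_of_lt hs))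

theorem tendsto_exp_neg_mul_sub_sq (q : ℂ) :
    Tendsto (fun s : ℝ => Complex.exp (-q * s - (s : ℂ) ^ 2 / 4)) atTop (𝓝 0) := by
  rw [tendsto_zero_iff_norm_tendsto_zero]
  have h : Tendsto (fun s : ℝ => Real.exp ((1 - q.re) ^ 2 + -s)) atTop (𝓝 0) :=
    Real.tendsto_exp_atBot.comp (tendsto_atBot_add_const_left _ _ tendsto_neg_atTop_atBot)
  refine squeeze_zero (fun _ => norm_nonneg _) (fun s => ?_) h
  rw [norm_exp_neg_mul_sub_sq]
  apply Real.exp_le_exp.2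
  nlinarith [sq_nonneg (s / 2 - (1 - q.re))]

/-- Integration by parts: `(q + s / 2) e^{-q s - s² / 4}` is an exact derivative. -/
theorem integral_mul_exp (q : ℂ) :
    ∫ s in Ioi (0 : ℝ), (s : ℂ) * Complex.exp (-q * s - (s : ℂ) ^ 2 / 4) =
      2 - 2 * q * gaussLaplace q := by
  have hK := (integrable_exp_neg_mul_sub_sq q).integrableOn (s := Ioi 0)
  have hI := integrableOn_mul_exp q
  have e : (fun s : ℝ => (-q - s / 2) * Complex.exp (-q * s - (s : ℂ) ^ 2 / 4)) =
      fun s : ℝ => -q * Complex.exp (-q * s - (s : ℂ) ^ 2 / 4) -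
        1 / 2 * ((s : ℂ) * Complex.exp (-q * s - (s : ℂ) ^ 2 / 4)) := by
    ext s; ring
  have h := integral_Ioi_of_hasDerivAt_of_tendsto' (a := 0)
    (fun s _ => hasDerivAt_exp_neg_mul_sub_sq q s)
    (by rw [e]; exact (hK.const_mul _).sub (hI.const_mul _)) (tendsto_exp_neg_mul_sub_sq q)
  rw [e, integral_sub (hK.const_mul _) (hI.const_mul _), integral_const_mul,
    integral_const_mul] at h
  simp only [Complex.ofReal_zero, mul_zero, ne_eq, OfNat.ofNat_ne_zero, not_false_eq_true,
    zero_pow, zero_div, sub_zero, Complex.exp_zero, zero_sub] at h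
  rw [gaussLaplace]
  linear_combination -2 * h

/-- The differential equation `K' = 2 q K - 2`. -/
theorem hasDerivAt_gaussLaplace (q : ℂ) :
    HasDerivAt gaussLaplace (2 * q * gaussLaplace q - 2) q := by
  have h := hasDerivAt_integral_of_dominated_loc_of_deriv_le
    (μ := volume.restrict (Ioi (0 : ℝ)))
    (F := fun (q : ℂ) (s : ℝ) => Complex.exp (-q * s - (s : ℂ) ^ 2 / 4))
    (F' := fun (q : ℂ) (s : ℝ) => -((s : ℂ) * Complex.exp (-q * s - (s : ℂ) ^ 2 / 4)))
    (x₀ := q) (s := Metric.ball q 1)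
    (bound := fun s : ℝ => ‖Complex.exp (-(q - 2) * s - (s : ℂ) ^ 2 / 4)‖)
    (Metric.ball_mem_nhds _ one_pos)
    (Eventually.of_forall fun r => Continuous.aestronglyMeasurable (by fun_prop))
    (integrable_exp_neg_mul_sub_sq q).integrableOn
    (Continuous.aestronglyMeasurable (by fun_prop))
    ((ae_restrict_iff' measurableSet_Ioi).2 (Eventually.of_forall fun s hs r hr => ?_))
    (integrable_exp_neg_mul_sub_sq (q - 2)).norm.integrableOn
    (Eventually.of_forall fun s r _ => ?_)
  · refine h.2.congr_deriv ?_
    rw [integral_neg, integral_mul_exp]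
    ring
  · rw [norm_neg]
    refine (norm_ofReal_mul_exp_le r (le_of_lt hs)).trans ?_
    rw [norm_exp_neg_mul_sub_sq, norm_exp_neg_mul_sub_sq]
    apply Real.exp_le_exp.2
    have h1 : |(r - q).re| < 1 :=
      (Complex.abs_re_le_norm _).trans_lt (by simpa [dist_eq_norm] using hr)
    rw [Complex.sub_re] at h1
    have h2 := (abs_lt.1 h1).1
    have hs' : 0 < s := hs
    simp only [Complex.sub_re, Complex.one_re, Complex.re_ofNat]
    nlinarith
  · have := (((hasDerivAt_id r).neg.mul_const (s : ℂ)).sub_const ((s : ℂ) ^ 2 / 4)).cexp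
    refine this.congr_deriv ?_
    simp
    ring

/-- On the closed right half plane, including the imaginary axis, where `1 / Re q` is useless. -/
theorem norm_gaussLaplace_le_two_div {q : ℂ} (hq : 0 ≤ q.re) (hq0 : q ≠ 0) :
    ‖gaussLaplace q‖ ≤ 2 / ‖q‖ := by
  have h1 : ‖2 - 2 * q * gaussLaplace q‖ ≤ 2 := by
    rw [← integral_mul_exp]
    refine (norm_integral_le_integral_norm _).trans ?_
    have h0 := integral_mul_exp 0
    have e : ∫ s in Ioi (0 : ℝ), s * Real.exp (- s ^ 2 / 4) = 2 := by
      have : ∫ s in Ioi (0 : ℝ), ((s * Real.exp (- s ^ 2 / 4) : ℝ) : ℂ) = 2 := by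
        rw [mul_zero, zero_mul, sub_zero] at h0
        rw [← h0]
        congr 1
        ext s
        push_cast
        congr 2
        ring
      rw [integral_complex_ofReal] at this
      exact_mod_cast this
    rw [← e]
    have hi : IntegrableOn (fun s : ℝ => s * Real.exp (- s ^ 2 / 4)) (Ioi 0) := by
      have := (integrable_mul_exp_neg_mul_sq (b := 1 / 4) (by norm_num)).integrableOn (s := Ioi 0)
      refine this.congr (Eventually.of_forall fun s => ?_)
      dsimp only
      congr 2
      ring
    refine setIntegral_mono_on (integrableOn_mul_exp q).norm hi measurableSet_Ioi fun s hs => ?_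
    have hs' : 0 < s := hs
    rw [norm_mul, norm_exp_neg_mul_sub_sq, Complex.norm_real, Real.norm_of_nonneg hs'.le]
    gcongr
    nlinarith
  have h2 : ‖2 * q * gaussLaplace q‖ ≤ 4 := by
    have := norm_sub_norm_le (2 * q * gaussLaplace q) 2
    rw [norm_sub_rev] at this
    have h3 : ‖(2 : ℂ)‖ = 2 := by simp
    linarith
  rw [norm_mul, norm_mul] at h2
  have h3 : ‖(2 : ℂ)‖ = 2 := by simp
  rw [h3] at h2
  rw [le_div_iff₀ (norm_pos_iff.2 hq0)]
  linarith

theorem norm_sinh_one_sub_I_mul_le {u : ℝ} (hu : 0 ≤ u) :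
    ‖Complex.sinh ((1 - Complex.I) * u)‖ ≤ Real.sqrt 2 * Real.sinh u := by
  have e : Complex.sinh ((1 - Complex.I) * u) =
      (Real.sinh u * Real.cos u : ℝ) + ((-(Real.cosh u * Real.sin u) : ℝ) : ℂ) * Complex.I := by
    rw [show (1 - Complex.I) * (u : ℂ) = u - u * Complex.I by ring, Complex.sinh_sub,
      Complex.sinh_mul_I, Complex.cosh_mul_I]
    push_cast
    ring
  rw [e, Complex.norm_add_mul_I]
  have h1 : |Real.sin u| ≤ Real.sinh u :=
    (Real.abs_sin_le_abs (x := u)).trans (by rw [abs_of_nonneg hu]; exact Real.self_le_sinh_iff.2 hu)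
  have h2 : Real.sin u ^ 2 ≤ Real.sinh u ^ 2 := by
    rw [← sq_abs]; gcongr
  have h3 : 0 ≤ Real.sinh u := Real.sinh_nonneg_iff.2 hu
  refine Real.sqrt_le_iff.2 ⟨by positivity, ?_⟩
  simp only [mul_pow, neg_sq]
  rw [Real.sq_sqrt (by norm_num), Real.cosh_sq, Real.cos_sq']
  linarith

/-- The bound for the image terms: the point `p = (1 - i) a` lies on the ray `arg p = -π / 4`.  The
factor `a` on the right comes from the cancellation between the two values and makes the bound vanish
at `a = 0`. -/
theorem norm_gaussLaplace_sub_le {a q : ℝ} (ha : 0 ≤ a) (haq : a < q) :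
    ‖gaussLaplace (q - (1 - Complex.I) * a) - gaussLaplace (q + (1 - Complex.I) * a)‖ ≤
      2 * Real.sqrt 2 * a / (q ^ 2 - a ^ 2) := by
  have e : gaussLaplace (q - (1 - Complex.I) * a) - gaussLaplace (q + (1 - Complex.I) * a) =
      ∫ s in Ioi (0 : ℝ), 2 * Complex.exp (-q * s - (s : ℂ) ^ 2 / 4) *
        Complex.sinh ((1 - Complex.I) * (a * s : ℝ)) := by
    rw [gaussLaplace, gaussLaplace, ← integral_sub
      (integrable_exp_neg_mul_sub_sq _).integrableOn
      (integrable_exp_neg_mul_sub_sq _).integrableOn]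
    congr 1
    ext s
    rw [Complex.sinh, show 2 * Complex.exp (-q * s - (s : ℂ) ^ 2 / 4) *
      ((Complex.exp ((1 - Complex.I) * (a * s : ℝ)) -
        Complex.exp (-((1 - Complex.I) * (a * s : ℝ)))) / 2) =
      Complex.exp (-q * s - (s : ℂ) ^ 2 / 4) * Complex.exp ((1 - Complex.I) * (a * s : ℝ)) -
      Complex.exp (-q * s - (s : ℂ) ^ 2 / 4) * Complex.exp (-((1 - Complex.I) * (a * s : ℝ)))
      by ring, ← Complex.exp_add, ← Complex.exp_add]
    congr 2 <;> push_cast <;> ring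
  have hI : ∫ s in Ioi (0 : ℝ),
      Real.sqrt 2 * (Real.exp (-(q - a) * s) - Real.exp (-(q + a) * s)) =
      2 * Real.sqrt 2 * a / (q ^ 2 - a ^ 2) := by
    rw [integral_const_mul, integral_sub (integrableOn_exp_neg_mul (by linarith))
      (integrableOn_exp_neg_mul (by linarith)), integral_exp_neg_mul (by linarith),
      integral_exp_neg_mul (by linarith)]
    have h1 : q - a ≠ 0 := by linarith
    have h2 : q + a ≠ 0 := by linarith
    rw [show q ^ 2 - a ^ 2 = (q - a) * (q + a) by ring]
    field_simp
    ring
  rw [e, ← hI]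
  refine norm_integral_le_of_norm_le (((integrableOn_exp_neg_mul (by linarith)).sub
      (integrableOn_exp_neg_mul (by linarith))).const_mul _)
      ((ae_restrict_iff' measurableSet_Ioi).2 (Eventually.of_forall fun s hs => ?_))
  have hs' : 0 < s := hs
  rw [norm_mul, norm_mul, norm_exp_neg_mul_sub_sq, Complex.ofReal_re]
  have h1 : Real.exp (-q * s - s ^ 2 / 4) ≤ Real.exp (-q * s) :=
    Real.exp_le_exp.2 (by nlinarith [sq_nonneg s])
  have h2 := norm_sinh_one_sub_I_mul_le (u := a * s) (by positivity)
  have h3 : ‖(2 : ℂ)‖ = 2 := by simp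
  rw [h3]
  calc 2 * Real.exp (-q * s - s ^ 2 / 4) * ‖Complex.sinh ((1 - Complex.I) * (a * s : ℝ))‖
      ≤ 2 * Real.exp (-q * s) * (Real.sqrt 2 * Real.sinh (a * s)) := by gcongr
    _ = Real.sqrt 2 * (Real.exp (-(q - a) * s) - Real.exp (-(q + a) * s)) := by
      rw [Real.sinh_eq, show -(q - a) * s = -q * s + a * s by ring,
        show -(q + a) * s = -q * s + -(a * s) by ring, Real.exp_add, Real.exp_add]
      ring

/-! ### Closed form of the Fresnel integral -/

/-- The point `e^{-iπ/4} x`, written as `(1 - i) (x / √2)`. -/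
noncomputable def ray (x : ℝ) : ℂ := (1 - Complex.I) * (x / Real.sqrt 2 : ℝ)

theorem ray_eq (x : ℝ) : ray x = Complex.exp (-(Complex.I * (Real.pi / 4))) * x := by
  have e : -(Complex.I * (Real.pi / 4)) = ((-(Real.pi / 4) : ℝ) : ℂ) * Complex.I := by
    push_cast; ring
  rw [e, Complex.exp_mul_I, ← Complex.ofReal_cos, ← Complex.ofReal_sin, Real.cos_neg, Real.sin_neg,
    Real.cos_pi_div_four, Real.sin_pi_div_four, ray]
  have h2 : (Real.sqrt 2 : ℂ) ^ 2 = 2 := by exact_mod_cast Real.sq_sqrt (x := 2) (by norm_num)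
  have h0 : (Real.sqrt 2 : ℂ) ≠ 0 := by
    intro h; rw [h] at h2; norm_num at h2
  push_cast
  field_simp
  linear_combination (Complex.I - 1) * x * h2

theorem ray_re (x : ℝ) : (ray x).re = x / Real.sqrt 2 := by
  rw [ray, Complex.re_mul_ofReal]; simp

theorem ray_neg (x : ℝ) : ray (-x) = -ray x := by
  rw [ray, ray]; push_cast; ring

theorem ray_sq (x : ℝ) : ray x ^ 2 = -(Complex.I * (x : ℂ) ^ 2) := by
  have h2 : (Real.sqrt 2 : ℂ) ^ 2 = 2 := by exact_mod_cast Real.sq_sqrt (x := 2) (by norm_num)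
  rw [ray, mul_pow]
  push_cast
  rw [div_pow, h2]
  linear_combination (x : ℂ) ^ 2 / 2 * Complex.I_sq

theorem norm_exp_neg_ray_sq (x : ℝ) : ‖Complex.exp (-ray x ^ 2)‖ = 1 := by
  rw [ray_sq, neg_neg, show Complex.I * (x : ℂ) ^ 2 = ((x ^ 2 : ℝ) : ℂ) * Complex.I by
    push_cast; ring, Complex.norm_exp_ofReal_mul_I]

theorem hasDerivAt_ray (x : ℝ) :
    HasDerivAt ray (Complex.exp (-(Complex.I * (Real.pi / 4)))) x := by
  have h : ray = fun x : ℝ => Complex.exp (-(Complex.I * (Real.pi / 4))) * (x : ℂ) :=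
    funext ray_eq
  rw [h]
  simpa using ((hasDerivAt_id (x : ℂ)).const_mul
    (Complex.exp (-(Complex.I * (Real.pi / 4))))).comp_ofReal

theorem sqrt_pi_ne_zero : (Real.sqrt Real.pi : ℂ) ≠ 0 := by
  exact_mod_cast (Real.sqrt_pos.2 Real.pi_pos).ne'

/-- The closed form `e^{-p²} K(p) / (2 √π)`, `p = e^{-iπ/4} x`, of the Fresnel integral. -/
noncomputable def fresnelClosed (x : ℝ) : ℂ :=
  Complex.exp (-ray x ^ 2) * gaussLaplace (ray x) / (2 * (Real.sqrt Real.pi : ℂ))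

theorem hasDerivAt_fresnelClosed (x : ℝ) :
    HasDerivAt fresnelClosed
      (-(Complex.exp (-(Complex.I * (Real.pi / 4))) / (Real.sqrt Real.pi : ℂ) *
        Complex.exp (Complex.I * (x : ℂ) ^ 2))) x := by
  have h1 := hasDerivAt_ray x
  have h2 : HasDerivAt (fun x => gaussLaplace (ray x)) _ x :=
    (hasDerivAt_gaussLaplace (ray x)).comp x h1
  have h3 := (((h1.pow 2).neg.cexp).mul h2).div_const (2 * (Real.sqrt Real.pi : ℂ))
  refine h3.congr_deriv ?_
  have := sqrt_pi_ne_zero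
  rw [show Complex.I * (x : ℂ) ^ 2 = -ray x ^ 2 by rw [ray_sq]; ring]
  simp only [Pi.neg_apply, Pi.pow_apply]
  field_simp
  ring

theorem norm_fresnelClosed (x : ℝ) :
    ‖fresnelClosed x‖ = ‖gaussLaplace (ray x)‖ / (2 * Real.sqrt Real.pi) := by
  rw [fresnelClosed, norm_div, norm_mul, norm_exp_neg_ray_sq, one_mul, norm_mul, Complex.norm_real,
    Real.norm_of_nonneg (Real.sqrt_nonneg _)]
  simp

theorem tendsto_fresnelClosed : Tendsto fresnelClosed atTop (𝓝 0) := by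
  rw [tendsto_zero_iff_norm_tendsto_zero]
  have h : Tendsto (fun x : ℝ => Real.sqrt 2 / (2 * Real.sqrt Real.pi) * x⁻¹) atTop (𝓝 0) := by
    simpa using tendsto_inv_atTop_zero.const_mul (Real.sqrt 2 / (2 * Real.sqrt Real.pi))
  refine squeeze_zero' (Eventually.of_forall fun _ => norm_nonneg _) ?_ h
  filter_upwards [eventually_gt_atTop 0] with x hx
  rw [norm_fresnelClosed]
  have h2 : 0 < Real.sqrt 2 := by positivity
  have h3 := norm_gaussLaplace_le_one_div (q := ray x) (by rw [ray_re]; positivity)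
  rw [ray_re] at h3
  have hp : 0 < Real.sqrt Real.pi := Real.sqrt_pos.2 Real.pi_pos
  calc _ ≤ 1 / (x / Real.sqrt 2) / (2 * Real.sqrt Real.pi) := by gcongr
    _ = _ := by field_simp

theorem truncF_eq (x T : ℝ) : truncF x T = fresnelClosed x - fresnelClosed T := by
  have h := intervalIntegral.integral_eq_sub_of_hasDerivAt (a := x) (b := T)
    (fun t _ => hasDerivAt_fresnelClosed t)
    (Continuous.intervalIntegrable (by fun_prop) _ _)
  rw [intervalIntegral.integral_neg, intervalIntegral.integral_const_mul] at h
  rw [truncF]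
  linear_combination -h

theorem tendsto_truncF (x : ℝ) :
    Tendsto (fun T : ℝ => truncF x T) atTop (𝓝 (fresnelClosed x)) := by
  simp only [truncF_eq]
  simpa using tendsto_fresnelClosed.const_sub (fresnelClosed x)

/-- The differential equation of `K` makes `fresnelClosed` a primitive of the integrand up to sign, and
it tends to `0` at infinity. -/
theorem F_eq (x : ℝ) :
    F x = Complex.exp (-ray x ^ 2) * gaussLaplace (ray x) / (2 * (Real.sqrt Real.pi : ℂ)) :=
  (tendsto_truncF x).limUnder_eq

theorem tendsto_truncF_F (x : ℝ) :
    Tendsto (fun T : ℝ => truncF x T) atTop (𝓝 (F x)) := by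
  have h : F x = fresnelClosed x := F_eq x
  rw [h]
  exact tendsto_truncF x

theorem norm_F (x : ℝ) : ‖F x‖ = ‖gaussLaplace (ray x)‖ / (2 * Real.sqrt Real.pi) := by
  rw [F_eq]; exact norm_fresnelClosed x

theorem F_neg (x : ℝ) : F (-x) = 1 - F x := by
  have h := gaussLaplace_add_neg (ray x)
  have h0 := sqrt_pi_ne_zero
  rw [F_eq, F_eq, ray_neg, neg_sq, eq_sub_iff_add_eq, ← add_div, ← mul_add,
    add_comm (gaussLaplace _), h, div_eq_one_iff_eq (by simpa using h0), mul_comm, mul_assoc,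
    ← Complex.exp_add]
  simp

theorem norm_F_le_half {x : ℝ} (hx : 0 ≤ x) : ‖F x‖ ≤ 1 / 2 := by
  have hp : 0 < Real.sqrt Real.pi := Real.sqrt_pos.2 Real.pi_pos
  rw [norm_F, div_le_iff₀ (by positivity)]
  have := norm_gaussLaplace_le_sqrt_pi (q := ray x) (by rw [ray_re]; positivity)
  linarith

theorem half_le_norm_F {x : ℝ} (hx : x ≤ 0) : 1 / 2 ≤ ‖F x‖ := by
  have h1 := norm_F_le_half (neg_nonneg.2 hx)
  have h2 : F x = 1 - F (-x) := by rw [F_neg]; ring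
  have h3 := norm_sub_norm_le 1 (F (-x))
  rw [h2]
  rw [norm_one] at h3
  linarith

theorem approxF_neg (N : ℕ) (x : ℝ) : approxF N (-x) = 1 - approxF N x := by
  rw [approxF, approxF]
  have : (A N : ℂ) * ((-x : ℝ) : ℂ) * Complex.exp (Complex.I * (Real.pi / 4)) =
      -((A N : ℂ) * (x : ℂ) * Complex.exp (Complex.I * (Real.pi / 4))) := by push_cast; ring
  rw [this, Complex.tan_neg]
  push_cast
  simp only [neg_sq]
  ring

/-! ### Poisson summation against an exponential weight -/

/-- Poisson summation for the Gaussian, from the functional equation of the two-variable theta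
function: the alternating sum of Gaussians centred at `2 α n` and the sum over the midpoint nodes
`(n - 1 / 2) π / α` have values in the ratio `1 : α / √π`. -/
theorem exists_hasSum_gaussian_image {α : ℝ} (hα : 0 < α) (s : ℝ) :
    ∃ θ : ℂ,
      HasSum (fun n : ℤ => (-1 : ℂ) ^ n * Complex.exp (-(α * n) ^ 2) *
        Complex.exp (α * n * s - (s : ℂ) ^ 2 / 4)) θ ∧
      HasSum (fun n : ℤ => Complex.exp (-((((n : ℝ) - 1 / 2) * Real.pi / α : ℝ) : ℂ) ^ 2) *
        Complex.exp (-(Complex.I * (((n : ℝ) - 1 / 2) * Real.pi / α : ℝ)) * s))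
        ((α / Real.sqrt Real.pi : ℝ) * θ) := by
  have hπ : (Real.pi : ℂ) ≠ 0 := by exact_mod_cast Real.pi_ne_zero
  have hα' : (α : ℂ) ≠ 0 := by exact_mod_cast hα.ne'
  set τ : ℂ := Complex.I * (α ^ 2 / Real.pi : ℝ) with hτ
  set z : ℂ := 1 / 2 - Complex.I * (α * s / (2 * Real.pi)) with hz
  have hτim : 0 < τ.im := by
    rw [hτ, Complex.I_mul_im, Complex.ofReal_re]
    have := Real.pi_pos
    positivity
  have hτ0 : τ ≠ 0 := fun h => by rw [h] at hτim; simp at hτim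
  have hinv : -1 / τ = Complex.I * (Real.pi / α ^ 2 : ℝ) := by
    rw [div_eq_iff hτ0, hτ]
    push_cast
    field_simp
    exact Complex.I_sq.symm
  have hτim' : 0 < (-1 / τ).im := by
    rw [hinv, Complex.I_mul_im, Complex.ofReal_re]
    have := Real.pi_pos
    positivity
  have h1 := hasSum_jacobiTheta₂_term z hτim
  have h2 := hasSum_jacobiTheta₂_term (z / τ) hτim'
  have hfe := jacobiTheta₂_functional_equation z τ
  have hroot : (-Complex.I * τ) ^ (1 / 2 : ℂ) = (α / Real.sqrt Real.pi : ℝ) := by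
    have : -Complex.I * τ = ((α ^ 2 / Real.pi : ℝ) : ℂ) := by
      rw [hτ, ← mul_assoc, neg_mul, Complex.I_mul_I]; ring
    rw [this, show (1 / 2 : ℂ) = ((1 / 2 : ℝ) : ℂ) by push_cast; rfl,
      ← Complex.ofReal_cpow (by have := Real.pi_pos; positivity), ← Real.sqrt_eq_rpow,
      Real.sqrt_div (by positivity), Real.sqrt_sq hα.le]
  rw [hroot] at hfe
  have hr0 : ((α / Real.sqrt Real.pi : ℝ) : ℂ) ≠ 0 := by
    have : 0 < Real.sqrt Real.pi := Real.sqrt_pos.2 Real.pi_pos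
    exact_mod_cast (by positivity : 0 < α / Real.sqrt Real.pi).ne'
  refine ⟨Complex.exp (-(s : ℂ) ^ 2 / 4) * jacobiTheta₂ z τ, ?_, ?_⟩
  · have e : (fun n : ℤ => (-1 : ℂ) ^ n * Complex.exp (-(α * n) ^ 2) *
        Complex.exp (α * n * s - (s : ℂ) ^ 2 / 4)) =
        fun n : ℤ => Complex.exp (-(s : ℂ) ^ 2 / 4) * jacobiTheta₂_term n z τ := by
      ext n
      have e : (-1 : ℂ) ^ n = Complex.exp (Real.pi * Complex.I * n) := by
        rw [mul_comm, Complex.exp_int_mul, Complex.exp_pi_mul_I]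
      simp only [jacobiTheta₂_term]
      rw [e, ← Complex.exp_add, ← Complex.exp_add, ← Complex.exp_add]
      congr 1
      rw [hz, hτ]
      push_cast
      field_simp
      linear_combination (4 * α * n * s - 4 * α ^ 2 * n ^ 2) * Complex.I_sq
    rw [e]
    exact h1.mul_left _
  · have e : (fun n : ℤ => Complex.exp (-((((n : ℝ) - 1 / 2) * Real.pi / α : ℝ) : ℂ) ^ 2) *
        Complex.exp (-(Complex.I * (((n : ℝ) - 1 / 2) * Real.pi / α : ℝ)) * s)) =
        fun n : ℤ => Complex.exp (-(s : ℂ) ^ 2 / 4) *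
          Complex.exp (-Real.pi * Complex.I * z ^ 2 / τ) *
          jacobiTheta₂_term n (z / τ) (-1 / τ) := by
      ext n
      have ez : Real.pi / α * (z - n) =
          -((((n : ℝ) - 1 / 2) * Real.pi / α : ℝ) + Complex.I * s / 2) := by
        rw [hz]; push_cast; field_simp; ring
      have e1 : -Real.pi * Complex.I * z ^ 2 / τ =
          Real.pi * Complex.I * z ^ 2 * (Complex.I * (Real.pi / α ^ 2 : ℝ)) := by
        rw [← hinv]; ring
      have e2 : z / τ = -z * (Complex.I * (Real.pi / α ^ 2 : ℝ)) := by
        rw [← hinv]; ring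
      simp only [jacobiTheta₂_term]
      rw [e1, e2, hinv, ← Complex.exp_add, ← Complex.exp_add, ← Complex.exp_add]
      congr 1
      have e3 : -(s : ℂ) ^ 2 / 4 +
          Real.pi * Complex.I * z ^ 2 * (Complex.I * (Real.pi / α ^ 2 : ℝ)) +
          (2 * Real.pi * Complex.I * n * (-z * (Complex.I * (Real.pi / α ^ 2 : ℝ))) +
            Real.pi * Complex.I * n ^ 2 * (Complex.I * (Real.pi / α ^ 2 : ℝ))) =
          -(s : ℂ) ^ 2 / 4 - (Real.pi / α * (z - n)) ^ 2 := by
        push_cast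
        linear_combination (Real.pi / α * (z - n)) ^ 2 * Complex.I_sq
      rw [e3, ez]
      linear_combination (s : ℂ) ^ 2 / 4 * Complex.I_sq
    have ev : ((α / Real.sqrt Real.pi : ℝ) : ℂ) *
        (Complex.exp (-(s : ℂ) ^ 2 / 4) * jacobiTheta₂ z τ) =
        Complex.exp (-(s : ℂ) ^ 2 / 4) * Complex.exp (-Real.pi * Complex.I * z ^ 2 / τ) *
          jacobiTheta₂ (z / τ) (-1 / τ) := by
      rw [hfe]
      field_simp
    rw [e, ev]
    exact h2.mul_left _

/-- Laplace transform of `s ↦ c e^{-w s}` for imaginary `w`: integrability, value, and `L¹` norm. -/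
theorem integral_exp_mul_const_mul_exp (p w c : ℂ) (hp : 0 < p.re) (hw : w.re = 0) :
    IntegrableOn (fun s : ℝ => Complex.exp (-p * s) * (c * Complex.exp (-w * s))) (Ioi 0) ∧
    ∫ s in Ioi (0 : ℝ), Complex.exp (-p * s) * (c * Complex.exp (-w * s)) = c / (p + w) ∧
    ∫ s in Ioi (0 : ℝ), ‖Complex.exp (-p * s) * (c * Complex.exp (-w * s))‖ = ‖c‖ / p.re := by
  have hre : (-(p + w)).re < 0 := by
    rw [Complex.neg_re, Complex.add_re, hw]; linarith
  have e : (fun s : ℝ => Complex.exp (-p * s) * (c * Complex.exp (-w * s))) =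
      fun s : ℝ => c * Complex.exp (-(p + w) * s) := by
    ext s
    rw [mul_left_comm, ← Complex.exp_add]
    congr 2
    ring
  rw [e]
  refine ⟨(integrableOn_exp_mul_complex_Ioi hre 0).const_mul c, ?_, ?_⟩
  · rw [integral_const_mul, integral_exp_mul_complex_Ioi hre]
    simp only [Complex.ofReal_zero, mul_zero, Complex.exp_zero, neg_div_neg_eq]
    ring
  · have e2 : (fun s : ℝ => ‖Complex.exp (-p * s) * (c * Complex.exp (-w * s))‖) =
        fun s : ℝ => ‖c‖ * Real.exp (-p.re * s) := by
      ext s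
      rw [show Complex.exp (-p * s) * (c * Complex.exp (-w * s)) =
        c * Complex.exp (-(p + w) * s) from congrFun e s, norm_mul, Complex.norm_exp,
        Complex.re_mul_ofReal, Complex.neg_re, Complex.add_re, hw, add_zero]
    rw [e2, integral_const_mul, integral_exp_neg_mul hp]
    ring

/-- The identity of `exists_hasSum_gaussian_image` integrated term by term against `e^{-p s}` over the
half line. -/
theorem hasSum_int_gaussian_div {α : ℝ} (hα : 0 < α) {p : ℂ} (hp : 0 < p.re) :
    ∃ S : ℂ,
      HasSum (fun n : ℤ => (-1 : ℂ) ^ n * Complex.exp (-(α * n) ^ 2) *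
        gaussLaplace (p - α * n)) S ∧
      HasSum (fun n : ℤ => Complex.exp (-((((n : ℝ) - 1 / 2) * Real.pi / α : ℝ) : ℂ) ^ 2) /
        (p + Complex.I * (((n : ℝ) - 1 / 2) * Real.pi / α : ℝ)))
        ((α / Real.sqrt Real.pi : ℝ) * S) := by
  choose θ hθ hθ' using exists_hasSum_gaussian_image hα
  refine ⟨∫ s in Ioi (0 : ℝ), Complex.exp (-p * s) * θ s, ?_, ?_⟩
  · have e : ∀ (n : ℤ) (s : ℝ), Complex.exp (-p * s) * ((-1 : ℂ) ^ n *
        Complex.exp (-(α * n) ^ 2) * Complex.exp (α * n * s - (s : ℂ) ^ 2 / 4)) =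
        (-1 : ℂ) ^ n * Complex.exp (-(α * n) ^ 2) *
          Complex.exp (-(p - α * n) * s - (s : ℂ) ^ 2 / 4) := by
      intro n s
      rw [mul_left_comm, ← Complex.exp_add]
      congr 2
      ring
    have h := hasSum_integral_of_summable_integral_norm
      (μ := volume.restrict (Ioi (0 : ℝ)))
      (F := fun (n : ℤ) (s : ℝ) => Complex.exp (-p * s) * ((-1 : ℂ) ^ n *
        Complex.exp (-(α * n) ^ 2) * Complex.exp (α * n * s - (s : ℂ) ^ 2 / 4))) ?_ ?_
    · have e2 : ∀ s : ℝ, ∑' n : ℤ, Complex.exp (-p * s) * ((-1 : ℂ) ^ n *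
        Complex.exp (-(α * n) ^ 2) * Complex.exp (α * n * s - (s : ℂ) ^ 2 / 4)) =
        Complex.exp (-p * s) * θ s := fun s => ((hθ s).mul_left _).tsum_eq
      simp only [e2] at h
      simp only [e, integral_const_mul] at h
      exact h
    · intro n
      simp only [e]
      exact (integrable_exp_neg_mul_sub_sq _).integrableOn.const_mul _
    · simp only [e]
      have e3 : ∀ n : ℤ, ∫ s in Ioi (0 : ℝ), ‖(-1 : ℂ) ^ n * Complex.exp (-(α * n) ^ 2) *
          Complex.exp (-(p - α * n) * s - (s : ℂ) ^ 2 / 4)‖ =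
          Real.exp (-(α * n) ^ 2) * ∫ s in Ioi (0 : ℝ),
            ‖Complex.exp (-(p - α * n) * s - (s : ℂ) ^ 2 / 4)‖ := by
        intro n
        rw [← integral_const_mul]
        congr 1
        ext s
        have : Complex.exp (-(α * n) ^ 2) = (Real.exp (-(α * n) ^ 2) : ℝ) := by push_cast; rfl
        rw [norm_mul, norm_mul, norm_zpow, norm_neg, norm_one, one_zpow, one_mul, this,
          Complex.norm_real, Real.norm_of_nonneg (Real.exp_pos _).le]
      simp only [e3]
      -- The rates `b = a / 2` for `n ≥ 0` and `b = 3 a / 2` for `n < 0`, where `a = Re p`, both give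
      -- the decay `e^{-a α |n|}`.
      have hbound : ∀ (n : ℤ) (b : ℝ), 0 < b →
          Real.exp (-(α * n) ^ 2) * (∫ s in Ioi (0 : ℝ),
            ‖Complex.exp (-(p - α * n) * s - (s : ℂ) ^ 2 / 4)‖) ≤
          Real.exp ((b - p.re) ^ 2 + 2 * (b - p.re) * α * n) / b := by
        intro n b hb
        have h := integral_norm_exp_neg_mul_sub_sq_le (p - α * n) hb
        have hre : (p - α * n).re = p.re - α * n := by
          rw [Complex.sub_re, show (α * n : ℂ) = ((α * n : ℝ) : ℂ) by push_cast; rfl,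
            Complex.ofReal_re]
        rw [hre] at h
        calc _ ≤ Real.exp (-(α * n) ^ 2) * (Real.exp ((b - (p.re - α * n)) ^ 2) / b) := by
              gcongr
          _ = _ := by rw [← mul_div_assoc, ← Real.exp_add]; congr 2; ring
      have hnn : ∀ n : ℤ, 0 ≤ Real.exp (-(α * n) ^ 2) * (∫ s in Ioi (0 : ℝ),
            ‖Complex.exp (-(p - α * n) * s - (s : ℂ) ^ 2 / 4)‖) := fun n =>
        mul_nonneg (Real.exp_pos _).le (integral_nonneg fun _ => norm_nonneg _)
      have hgeo : Summable fun n : ℕ => Real.exp (-(p.re * α) * n) := by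
        have : (fun n : ℕ => Real.exp (-(p.re * α) * n)) =
            fun n : ℕ => Real.exp (-(p.re * α)) ^ n := by
          ext n; rw [← Real.exp_nat_mul]; congr 1; ring
        rw [this]
        exact summable_geometric_of_lt_one (Real.exp_pos _).le
          (Real.exp_lt_one_iff.2 (by nlinarith))
      refine Summable.of_nat_of_neg ?_ ?_
      · refine Summable.of_nonneg_of_le (fun n => hnn n) (fun n => hbound n (p.re / 2) (by linarith))
          ?_
        refine (hgeo.mul_left (Real.exp ((p.re / 2) ^ 2) / (p.re / 2))).congr fun n => ?_
        rw [div_mul_eq_mul_div, ← Real.exp_add]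
        congr 2
        push_cast
        ring
      · refine Summable.of_nonneg_of_le (fun n => hnn _)
          (fun n => hbound _ (p.re * 3 / 2) (by linarith)) ?_
        refine (hgeo.mul_left (Real.exp ((p.re / 2) ^ 2) / (p.re * 3 / 2))).congr fun n => ?_
        rw [div_mul_eq_mul_div, ← Real.exp_add]
        congr 2
        push_cast
        ring
  · have hw : ∀ t : ℝ, (Complex.I * t).re = 0 := fun t => by simp
    have hsum : Summable fun n : ℤ =>
        ‖Complex.exp (-((((n : ℝ) - 1 / 2) * Real.pi / α : ℝ) : ℂ) ^ 2)‖ := by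
      have := (hθ' 0).summable.norm
      simpa using this
    have h := hasSum_integral_of_summable_integral_norm
      (μ := volume.restrict (Ioi (0 : ℝ)))
      (F := fun (n : ℤ) (s : ℝ) => Complex.exp (-p * s) *
        (Complex.exp (-((((n : ℝ) - 1 / 2) * Real.pi / α : ℝ) : ℂ) ^ 2) *
        Complex.exp (-(Complex.I * (((n : ℝ) - 1 / 2) * Real.pi / α : ℝ)) * s)))
      (fun n => (integral_exp_mul_const_mul_exp p _ _ hp (hw _)).1) ?_
    · have e2 : ∀ s : ℝ, ∑' n : ℤ, Complex.exp (-p * s) *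
        (Complex.exp (-((((n : ℝ) - 1 / 2) * Real.pi / α : ℝ) : ℂ) ^ 2) *
        Complex.exp (-(Complex.I * (((n : ℝ) - 1 / 2) * Real.pi / α : ℝ)) * s)) =
        (α / Real.sqrt Real.pi : ℝ) * (Complex.exp (-p * s) * θ s) := fun s => by
        rw [((hθ' s).mul_left _).tsum_eq]; ring
      simp only [e2] at h
      rw [integral_const_mul] at h
      have key := fun (c : ℂ) (t : ℝ) =>
        (integral_exp_mul_const_mul_exp p (Complex.I * t) c hp (hw t)).2.1
      simp only [key] at h
      exact h
    · refine (hsum.div_const p.re).congr fun n => ?_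
      exact ((integral_exp_mul_const_mul_exp p _ _ hp (hw _)).2.2).symm

/-! ### Exact formula for the quadrature error -/

theorem add_I_mul_ofReal_ne_zero {p : ℂ} (hp : 0 < p.re) (t : ℝ) : p + Complex.I * t ≠ 0 := by
  intro h
  have := congrArg Complex.re h
  simp at this
  linarith

theorem sq_add_sq_ne_zero {p : ℂ} (hp : 0 < p.re) (t : ℝ) : p ^ 2 + (t : ℂ) ^ 2 ≠ 0 := by
  have h1 := add_I_mul_ofReal_ne_zero hp t
  have h2 := add_I_mul_ofReal_ne_zero hp (-t)
  have : p ^ 2 + (t : ℂ) ^ 2 = (p + Complex.I * t) * (p + Complex.I * (-t : ℝ)) := by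
    push_cast
    linear_combination ((t : ℂ) ^ 2) * Complex.I_sq
  rw [this]
  exact mul_ne_zero h1 h2

/-- A restatement of a sum with other expressions for its terms and value. -/
theorem hasSum_of_eq {f g : ℕ → ℂ} {a b : ℂ} (h : HasSum f a) (hf : ∀ n, g n = f n)
    (hb : b = a) : HasSum g b := by
  rw [funext hf, hb]
  exact h

/-- `hasSum_int_gaussian_div` with opposite indices paired on the image side and opposite nodes paired
on the quadrature side. -/
theorem hasSum_nat_gaussian_div {α : ℝ} (hα : 0 < α) {p : ℂ} (hp : 0 < p.re) :
    ∃ T : ℂ,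
      HasSum (fun n : ℕ => (-1 : ℂ) ^ (n + 1) * Complex.exp (-(α * (n + 1)) ^ 2) *
        (gaussLaplace (p - α * (n + 1)) + gaussLaplace (p + α * (n + 1)))) T ∧
      HasSum (fun m : ℕ => Complex.exp (-((((m : ℝ) + 1 / 2) * Real.pi / α : ℝ) : ℂ) ^ 2) *
        (p / (p ^ 2 + ((((m : ℝ) + 1 / 2) * Real.pi / α : ℝ) : ℂ) ^ 2)))
        ((α / (2 * Real.sqrt Real.pi) : ℝ) * (gaussLaplace p + T)) := by
  obtain ⟨S, h1, h2⟩ := hasSum_int_gaussian_div hα hp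
  refine ⟨S - gaussLaplace p, ?_, ?_⟩
  · have h := (hasSum_nat_add_iff' 1).2 h1.nat_add_neg
    refine hasSum_of_eq h (fun n => ?_) ?_
    · have e : (-1 : ℂ) ^ (-((n + 1 : ℕ) : ℤ)) = (-1 : ℂ) ^ (n + 1) := by
        rw [zpow_neg, zpow_natCast, ← inv_pow]; norm_num
      rw [e, zpow_natCast]
      push_cast
      rw [show (α * -((n : ℂ) + 1)) ^ 2 = (α * ((n : ℂ) + 1)) ^ 2 by ring,
        show p - α * -((n : ℂ) + 1) = p + α * ((n : ℂ) + 1) by ring]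
      ring
    · simp
  · have h3 := ((Equiv.addRight (1 : ℤ)).hasSum_iff).2 h2
    have h4 := h3.nat_add_neg_add_one.mul_left (1 / 2)
    refine hasSum_of_eq h4 (fun m => ?_) ?_
    · simp only [Function.comp_apply, Equiv.coe_addRight]
      have e1 : ((((m : ℤ) + 1 : ℤ) : ℝ) - 1 / 2) * Real.pi / α =
          ((m : ℝ) + 1 / 2) * Real.pi / α := by push_cast; ring
      have e2 : (((-((m : ℤ) + 1) + 1 : ℤ) : ℝ) - 1 / 2) * Real.pi / α =
          -(((m : ℝ) + 1 / 2) * Real.pi / α) := by push_cast; ring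
      rw [e1, e2]
      generalize ((m : ℝ) + 1 / 2) * Real.pi / α = t
      have n1 := add_I_mul_ofReal_ne_zero hp t
      have n2 := add_I_mul_ofReal_ne_zero hp (-t)
      have n3 := sq_add_sq_ne_zero hp t
      have n4 : (p + Complex.I * t) * (p + Complex.I * (-t : ℝ)) = p ^ 2 + (t : ℂ) ^ 2 := by
        push_cast
        linear_combination (-(t : ℂ) ^ 2) * Complex.I_sq
      rw [div_add_div _ _ n1 n2, n4]
      push_cast
      rw [neg_sq]
      field_simp
      ring
    · push_cast
      field_simp
      ring

theorem A_pos (N : ℕ) : 0 < A N := by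
  have := Real.pi_pos
  exact Real.sqrt_pos.2 (by positivity)

theorem node_succ (N m : ℕ) : node N (m + 1) = ((m : ℝ) + 1 / 2) * Real.pi / A N := by
  rw [node, A]
  push_cast
  ring

/-- The term of index `k = m + 1` of the quadrature sum in `approxF`, with its prefactor. -/
noncomputable def quadTerm (N : ℕ) (x : ℝ) (m : ℕ) : ℂ :=
  (x : ℂ) / (A N : ℂ) * Complex.exp (Complex.I * ((x : ℂ) ^ 2 + Real.pi / 4)) *
    (Complex.exp (-(node N (m + 1) : ℂ) ^ 2) /
      ((x : ℂ) ^ 2 + Complex.I * (node N (m + 1) : ℂ) ^ 2))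

theorem ray_re_pos {x : ℝ} (hx : 0 < x) : 0 < (ray x).re := by
  rw [ray_re]; positivity

/-- Each quadrature term as a multiple of `p / (p² + t²)`, using `x² + i t² = i (p² + t²)`. -/
theorem quadTerm_eq (N : ℕ) {x : ℝ} (hx : 0 < x) (m : ℕ) :
    quadTerm N x m = Complex.exp (-ray x ^ 2) / A N *
      (Complex.exp (-((((m : ℝ) + 1 / 2) * Real.pi / A N : ℝ) : ℂ) ^ 2) *
        (ray x / (ray x ^ 2 + ((((m : ℝ) + 1 / 2) * Real.pi / A N : ℝ) : ℂ) ^ 2))) := by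
  rw [quadTerm, node_succ]
  generalize ((m : ℝ) + 1 / 2) * Real.pi / A N = t
  have h1 := sq_add_sq_ne_zero (ray_re_pos hx) t
  have h2 : (x : ℂ) ^ 2 + Complex.I * (t : ℂ) ^ 2 = Complex.I * (ray x ^ 2 + (t : ℂ) ^ 2) := by
    rw [ray_sq]; linear_combination (x : ℂ) ^ 2 * Complex.I_sq
  have h3 : Complex.exp (Complex.I * ((x : ℂ) ^ 2 + Real.pi / 4)) * x =
      Complex.I * (Complex.exp (-ray x ^ 2) * ray x) := by
    rw [ray_eq, ← ray_eq, ray_sq, ray_eq]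
    have : Complex.I = Complex.exp (Real.pi / 2 * Complex.I) := Complex.exp_pi_div_two_mul_I.symm
    nth_rw 2 [this]
    rw [← mul_assoc, ← mul_assoc, ← Complex.exp_add, ← Complex.exp_add]
    congr 2
    ring
  have hA : (A N : ℂ) ≠ 0 := by exact_mod_cast (A_pos N).ne'
  have hI := Complex.I_ne_zero
  rw [h2]
  generalize Complex.exp (Complex.I * ((x : ℂ) ^ 2 + Real.pi / 4)) = E at h3 ⊢
  field_simp
  linear_combination h3

theorem one_add_exp_ne_zero {w : ℂ} (hw : 0 < w.re) : 1 + Complex.exp w ≠ 0 := by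
  intro h
  have h1 : Complex.exp w = -1 := by linear_combination h
  have h2 := congrArg norm h1
  rw [Complex.norm_exp, norm_neg, norm_one, Real.exp_eq_one_iff] at h2
  linarith

/-- The tangent correction as a value of the logistic function. -/
theorem tan_term_eq {w : ℂ} (hw : 0 < w.re) :
    1 / 2 + Complex.I / 2 * Complex.tan (w * Complex.I) = 1 / (1 + Complex.exp (2 * w)) := by
  have h := one_add_exp_ne_zero (w := 2 * w) (by simpa using hw)
  rw [Complex.tan_mul_I, Complex.tanh_eq_sinh_div_cosh, Complex.sinh, Complex.cosh]
  have e : Complex.exp (2 * w) = Complex.exp w * Complex.exp w := by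
    rw [← Complex.exp_add]; congr 1; ring
  have e' : Complex.exp w * Complex.exp (-w) = 1 := by rw [← Complex.exp_add]; simp
  have h2 : Complex.exp w + Complex.exp (-w) ≠ 0 := by
    intro h3
    apply h
    rw [e]
    linear_combination Complex.exp w * h3 - e'
  rw [e] at h ⊢
  have hn := Complex.exp_ne_zero w
  rw [Complex.exp_neg] at h2 ⊢
  generalize Complex.exp w = E at *
  have h4 : E ^ 2 + 1 ≠ 0 := by rwa [add_comm, sq]
  have e5 : (E - E⁻¹) / 2 / ((E + E⁻¹) / 2) = (E ^ 2 - 1) / (E ^ 2 + 1) := by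
    field_simp
  rw [e5, show Complex.I / 2 * ((E ^ 2 - 1) / (E ^ 2 + 1) * Complex.I) =
    Complex.I ^ 2 * ((E ^ 2 - 1) / (E ^ 2 + 1)) / 2 by ring, Complex.I_sq,
    show 1 + E * E = E ^ 2 + 1 by ring]
  field_simp
  ring

theorem approxF_eq (N : ℕ) {x : ℝ} (hx : 0 < x) :
    approxF N x = 1 / (1 + Complex.exp (2 * (A N * ray x))) +
      ∑ m ∈ Finset.range N, quadTerm N x m := by
  have hA := A_pos N
  have h1 : (A N : ℂ) * (x : ℂ) * Complex.exp (Complex.I * (Real.pi / 4)) =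
      (A N * ray x) * Complex.I := by
    rw [ray_eq]
    have : Complex.I = Complex.exp (Real.pi / 2 * Complex.I) := Complex.exp_pi_div_two_mul_I.symm
    have h : Complex.exp (Complex.I * (Real.pi / 4)) =
        Complex.exp (-(Complex.I * (Real.pi / 4))) * Complex.I := by
      nth_rw 3 [this]
      rw [← Complex.exp_add]
      congr 1
      ring
    rw [h]
    ring
  have h2 : 0 < (A N * ray x).re := by
    rw [Complex.re_ofReal_mul]
    exact mul_pos hA (ray_re_pos hx)
  rw [approxF, h1, tan_term_eq h2]
  congr 1
  simp only [quadTerm]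
  rw [← Finset.mul_sum]
  congr 1
  rw [Finset.range_eq_Ico, Finset.sum_Ico_add' (fun k => Complex.exp (-(node N k : ℂ) ^ 2) /
      ((x : ℂ) ^ 2 + Complex.I * (node N k : ℂ) ^ 2)) 0 N 1]
  rfl

/-- The error is the truncated tail of the quadrature sum plus the image terms and the tangent
correction. -/
theorem exists_error_eq (N : ℕ) {x : ℝ} (hx : 0 < x) :
    ∃ T : ℂ,
      HasSum (fun n : ℕ => (-1 : ℂ) ^ (n + 1) * Complex.exp (-(A N * (n + 1)) ^ 2) *
        (gaussLaplace (ray x - A N * (n + 1)) + gaussLaplace (ray x + A N * (n + 1)))) T ∧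
      HasSum (fun m => quadTerm N x (m + N))
        (F x - approxF N x - (-(Complex.exp (-ray x ^ 2) / (2 * (Real.sqrt Real.pi : ℂ)) * T) -
          1 / (1 + Complex.exp (2 * (A N * ray x))))) := by
  obtain ⟨T, h1, h2⟩ := hasSum_nat_gaussian_div (A_pos N) (ray_re_pos hx)
  refine ⟨T, h1, ?_⟩
  have h3 : HasSum (quadTerm N x) _ :=
    (funext fun m => quadTerm_eq N hx m : quadTerm N x = _) ▸
      h2.mul_left (Complex.exp (-ray x ^ 2) / A N)
  have h4 := (hasSum_nat_add_iff' N).2 h3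
  refine hasSum_of_eq h4 (fun _ => rfl) ?_
  rw [approxF_eq N hx, F_eq]
  have hA : (A N : ℂ) ≠ 0 := by exact_mod_cast (A_pos N).ne'
  have := sqrt_pi_ne_zero
  push_cast
  field_simp
  ring

/-- Reflection of `K(p - A n)` into `K(A n - p)` produces `∑ (-1)ⁿ e^{-2 A n p}`, which cancels the
tangent correction. -/
theorem hasSum_error_of_reflection (N : ℕ) {x : ℝ} (hx : 0 < x) {T : ℂ}
    (hT : HasSum (fun n : ℕ => (-1 : ℂ) ^ (n + 1) * Complex.exp (-(A N * (n + 1)) ^ 2) *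
        (gaussLaplace (ray x - A N * (n + 1)) + gaussLaplace (ray x + A N * (n + 1)))) T) :
    HasSum (fun n : ℕ => Complex.exp (-ray x ^ 2) / (2 * (Real.sqrt Real.pi : ℂ)) *
        ((-1 : ℂ) ^ (n + 1) * Complex.exp (-(A N * (n + 1)) ^ 2) *
        (gaussLaplace (A N * (n + 1) - ray x) - gaussLaplace (A N * (n + 1) + ray x))))
      (-(Complex.exp (-ray x ^ 2) / (2 * (Real.sqrt Real.pi : ℂ)) * T) -
          1 / (1 + Complex.exp (2 * (A N * ray x)))) := by
  have hw : 0 < (2 * (A N * ray x)).re := by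
    rw [show (2 * (A N * ray x) : ℂ) = ((2 * A N : ℝ) : ℂ) * ray x by push_cast; ring,
      Complex.re_ofReal_mul]
    have := A_pos N
    have := ray_re_pos hx
    positivity
  have hne := one_add_exp_ne_zero hw
  have hgeo : HasSum (fun n : ℕ => (-1 : ℂ) ^ (n + 1) *
      Complex.exp (-(2 * (A N * ray x)) * (n + 1))) (-(1 / (1 + Complex.exp (2 * (A N * ray x))))) := by
    have h := hasSum_geometric_of_norm_lt_one (ξ := -Complex.exp (-(2 * (A N * ray x)))) (by
      rw [norm_neg, Complex.norm_exp, Real.exp_lt_one_iff, Complex.neg_re]; linarith)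
    have h' := h.mul_left (-Complex.exp (-(2 * (A N * ray x))))
    refine hasSum_of_eq h' (fun n => ?_) ?_
    · rw [← pow_succ', neg_pow (Complex.exp _), ← Complex.exp_nat_mul]
      congr 2
      push_cast
      ring
    · have hE := Complex.exp_ne_zero (2 * (A N * ray x))
      have h5 : Complex.exp (2 * (A N * ray x)) + 1 ≠ 0 := by rwa [add_comm]
      rw [sub_neg_eq_add, Complex.exp_neg]
      field_simp
      ring
  have hc := (hT.mul_left (-(Complex.exp (-ray x ^ 2) / (2 * (Real.sqrt Real.pi : ℂ))))).add hgeo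
  refine hasSum_of_eq hc (fun n => ?_) ?_
  · have hr := gaussLaplace_add_neg (ray x - A N * (n + 1))
    have he : Complex.exp (-ray x ^ 2) * (Complex.exp (-(A N * (n + 1)) ^ 2) *
        Complex.exp ((ray x - A N * (n + 1)) ^ 2)) =
        Complex.exp (-(2 * (A N * ray x)) * (n + 1)) := by
      rw [← Complex.exp_add, ← Complex.exp_add]
      congr 1
      ring
    rw [← he, show (A N * (n + 1) - ray x : ℂ) = -(ray x - A N * (n + 1)) by ring,
      ← sub_eq_iff_eq_add'.2 hr.symm, add_comm (A N * (n + 1) : ℂ) (ray x)]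
    have := sqrt_pi_ne_zero
    field_simp
    ring
  · ring

/-! ### The pointwise error bound -/

theorem norm_le_of_hasSum_geometric {f : ℕ → ℂ} {a : ℂ} (h : HasSum f a) {C r : ℝ} (hr0 : 0 ≤ r)
    (hr1 : r < 1) (hf : ∀ n, ‖f n‖ ≤ C * r ^ n) : ‖a‖ ≤ C / (1 - r) := by
  rw [← h.tsum_eq, div_eq_mul_inv]
  exact tsum_of_norm_bounded ((hasSum_geometric_of_lt_one hr0 hr1).mul_left C) hf

theorem A_sq (N : ℕ) : A N ^ 2 = ((N : ℝ) + 1 / 2) * Real.pi :=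
  Real.sq_sqrt (by have := Real.pi_pos; positivity)

theorem exp_neg_two_A_sq_lt_one (N : ℕ) : Real.exp (-2 * A N ^ 2) < 1 := by
  rw [Real.exp_lt_one_iff]
  have := A_pos N
  nlinarith [pow_pos this 2]

theorem norm_exp_neg_sq (N n : ℕ) :
    ‖Complex.exp (-(A N * (n + 1)) ^ 2)‖ = Real.exp (-(A N * (n + 1)) ^ 2) := by
  have : Complex.exp (-(A N * (n + 1)) ^ 2) = (Real.exp (-(A N * (n + 1)) ^ 2) : ℝ) := by
    push_cast; rfl
  rw [this, Complex.norm_real, Real.norm_of_nonneg (Real.exp_pos _).le]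

theorem exp_neg_sq_le (N n : ℕ) : Real.exp (-(A N * (n + 1)) ^ 2) ≤
    Real.exp (-(A N) ^ 2) * Real.exp (-2 * A N ^ 2) ^ n := by
  rw [← Real.exp_nat_mul, ← Real.exp_add]
  apply Real.exp_le_exp.2
  nlinarith [mul_nonneg (sq_nonneg (A N)) (sq_nonneg (n : ℝ))]

theorem norm_prefactor (x : ℝ) :
    ‖Complex.exp (-ray x ^ 2) / (2 * (Real.sqrt Real.pi : ℂ))‖ = 1 / (2 * Real.sqrt Real.pi) := by
  rw [norm_div, norm_exp_neg_ray_sq, norm_mul, Complex.norm_real,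
    Real.norm_of_nonneg (Real.sqrt_nonneg _)]
  simp

/-- A bound `M` common to all differences `K(A n - p) - K(A n + p)` bounds the series, because
`(n + 1)² ≥ 1 + 2 n`. -/
theorem norm_le_of_forall_norm_gaussLaplace_sub_le (N : ℕ) (x : ℝ) {M : ℝ} {e : ℂ}
    (he : HasSum (fun n : ℕ => Complex.exp (-ray x ^ 2) / (2 * (Real.sqrt Real.pi : ℂ)) *
        ((-1 : ℂ) ^ (n + 1) * Complex.exp (-(A N * (n + 1)) ^ 2) *
        (gaussLaplace (A N * (n + 1) - ray x) - gaussLaplace (A N * (n + 1) + ray x)))) e)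
    (hM : ∀ n : ℕ, ‖gaussLaplace (A N * (n + 1) - ray x) -
      gaussLaplace (A N * (n + 1) + ray x)‖ ≤ M) :
    ‖e‖ ≤ M / (2 * Real.sqrt Real.pi) * Real.exp (-(A N) ^ 2) / (1 - Real.exp (-2 * A N ^ 2)) := by
  refine norm_le_of_hasSum_geometric he (Real.exp_pos _).le (exp_neg_two_A_sq_lt_one N)
    fun n => ?_
  have h1 := exp_neg_sq_le N n
  have hM0 : 0 ≤ M := (norm_nonneg _).trans (hM 0)
  rw [norm_mul, norm_prefactor, norm_mul, norm_mul, norm_pow, norm_neg, norm_one, one_pow, one_mul,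
    norm_exp_neg_sq]
  calc _ ≤ 1 / (2 * Real.sqrt Real.pi) *
        ((Real.exp (-(A N) ^ 2) * Real.exp (-2 * A N ^ 2) ^ n) * M) := by
        gcongr
        exact hM n
    _ = _ := by ring

theorem norm_gaussLaplace_sub_ray_le (N n : ℕ) {x : ℝ} (hx : 0 ≤ x)
    (h : x / Real.sqrt 2 < A N * (n + 1)) :
    ‖gaussLaplace (A N * (n + 1) - ray x) - gaussLaplace (A N * (n + 1) + ray x)‖ ≤
      2 * Real.sqrt 2 * (x / Real.sqrt 2) /
        ((A N * (n + 1)) ^ 2 - (x / Real.sqrt 2) ^ 2) := by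
  have h := norm_gaussLaplace_sub_le (a := x / Real.sqrt 2) (by positivity) h
  rw [ray]
  push_cast at h ⊢
  exact h

/-- The term `n = 1` when `a` is near `A`, or above it. -/
theorem norm_gaussLaplace_near_le {A a : ℝ} (hA : 0 < A) (h1 : 3 / 4 * A < a) :
    ‖gaussLaplace (A - (1 - Complex.I) * a) - gaussLaplace (A + (1 - Complex.I) * a)‖ ≤
      8 * Real.sqrt 2 * a / (A * (A + a)) := by
  have ha : 0 < a := by linarith
  have hs2 : (1.41 : ℝ) ≤ Real.sqrt 2 := Real.le_sqrt_of_sq_le (by norm_num)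
  have hre1 : ((A : ℂ) - (1 - Complex.I) * a).re = A - a := by simp
  have him1 : ((A : ℂ) - (1 - Complex.I) * a).im = a := by simp
  have hre2 : ((A : ℂ) + (1 - Complex.I) * a).re = A + a := by simp
  set q : ℂ := (A : ℂ) - (1 - Complex.I) * a with hq
  have hq0 : q ≠ 0 := fun h => by rw [h] at him1; simp at him1; linarith
  have hnq : a ≤ ‖q‖ := by
    have := Complex.abs_im_le_norm q
    rwa [him1, abs_of_pos ha] at this
  have h2 := norm_gaussLaplace_le_one_div (q := (A : ℂ) + (1 - Complex.I) * a)
    (by rw [hre2]; linarith)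
  rw [hre2] at h2
  have hdiv : 2 / ‖q‖ ≤ 2 / a := by gcongr
  have hsub := norm_sub_le (gaussLaplace q) (gaussLaplace ((A : ℂ) + (1 - Complex.I) * a))
  refine hsub.trans ?_
  have hAa : 0 < A + a := by linarith
  rcases le_or_gt a A with h | h
  · have h3 := norm_gaussLaplace_le_two_div (q := q) (by rw [hre1]; linarith) hq0
    have h4 : 2 / a + 1 / (A + a) ≤ 8 * Real.sqrt 2 * a / (A * (A + a)) := by
      rw [div_add_div _ _ ha.ne' hAa.ne', div_le_div_iff₀ (by positivity) (by positivity)]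
      have h8 : 8 * 1.41 * a * a ≤ 8 * Real.sqrt 2 * a * a := by gcongr
      have h9 : A * A ≤ (4 / 3 * a) * (4 / 3 * a) := by gcongr <;> linarith
      have h10 : a * A ≤ a * (4 / 3 * a) := by gcongr; linarith
      have : (2 * (A + a) + a * 1) * A ≤ 8 * Real.sqrt 2 * a * a := by nlinarith
      nlinarith
    linarith
  -- For `Re q < 0` reflection replaces `q` by `-q`.
  · have h3 := norm_gaussLaplace_le_two_div (q := -q) (by rw [Complex.neg_re, hre1]; linarith)
      (neg_ne_zero.2 hq0)
    rw [norm_neg] at h3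
    have h5 : gaussLaplace q = 2 * (Real.sqrt Real.pi : ℂ) * Complex.exp (q ^ 2) -
        gaussLaplace (-q) := by rw [← gaussLaplace_add_neg]; ring
    have h6 : ‖2 * (Real.sqrt Real.pi : ℂ) * Complex.exp (q ^ 2)‖ ≤
        2 * Real.sqrt Real.pi * Real.exp (-A ^ 2) := by
      rw [norm_mul, norm_mul, Complex.norm_real, Real.norm_of_nonneg (Real.sqrt_nonneg _),
        Complex.norm_exp, sq q, Complex.mul_re, hre1, him1]
      have : ‖(2 : ℂ)‖ = 2 := by simp
      rw [this]
      gcongr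
      nlinarith
    have h7 : ‖gaussLaplace q‖ ≤ 2 * Real.sqrt Real.pi * Real.exp (-A ^ 2) + 2 / a := by
      rw [h5]
      refine (norm_sub_le _ _).trans ?_
      linarith
    have hsp : Real.sqrt Real.pi ≤ 2 := by
      rw [Real.sqrt_le_left (by norm_num)]; linarith [Real.pi_le_four]
    have h8 : 2 * Real.sqrt Real.pi * Real.exp (-A ^ 2) ≤ 2 / A := by
      have h9 : A * Real.exp (-A ^ 2) ≤ 1 / 2 := by
        rw [Real.exp_neg, ← div_eq_mul_inv, div_le_iff₀ (Real.exp_pos _)]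
        have := Real.add_one_le_exp (A ^ 2)
        nlinarith [sq_nonneg (A - 1)]
      rw [le_div_iff₀ hA]
      nlinarith [Real.exp_pos (-A ^ 2), Real.sqrt_nonneg Real.pi, mul_pos hA (Real.exp_pos (-A ^ 2))]
    have h4 : 2 / A + 2 / a + 1 / (A + a) ≤ 8 * Real.sqrt 2 * a / (A * (A + a)) := by
      rw [div_add_div _ _ hA.ne' ha.ne', div_add_div _ _ (by positivity) hAa.ne',
        div_le_div_iff₀ (by positivity) (by positivity)]
      have h11 : 8 * 1.41 * a * a ≤ 8 * Real.sqrt 2 * a * a := by gcongr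
      have h12 : A * A ≤ a * a := by gcongr
      have h13 : a * A ≤ a * a := by gcongr
      have : (2 * a + A * 2) * (A + a) + A * a * 1 ≤ 8 * Real.sqrt 2 * a * a := by nlinarith
      have h10 : 0 ≤ A * (A + a) := by positivity
      nlinarith
    linarith

theorem norm_inv_one_add_exp_le {w : ℂ} (hw : 0 < w.re) :
    ‖1 / (1 + Complex.exp w)‖ ≤ Real.exp (-w.re) / (1 - Real.exp (-w.re)) := by
  have h1 : 1 < Real.exp w.re := Real.one_lt_exp_iff.2 hw
  have h2 : Real.exp w.re - 1 ≤ ‖1 + Complex.exp w‖ := by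
    have := norm_sub_le (1 + Complex.exp w) 1
    rw [add_sub_cancel_left, Complex.norm_exp, norm_one] at this
    linarith
  have h3 : Real.exp (-w.re) / (1 - Real.exp (-w.re)) = 1 / (Real.exp w.re - 1) := by
    rw [Real.exp_neg]
    have : Real.exp w.re - 1 ≠ 0 := by linarith
    have := (Real.exp_pos w.re).ne'
    field_simp
  rw [norm_div, norm_one, h3]
  exact one_div_le_one_div_of_le (by linarith) h2

/-- The series before reflection, for `a > A`: in each term the decay rate `a - A` is kept, which leaves
`e^{-A² n² + A² (n - 1)²} = e^{-(2 n - 1) A²}`. -/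
theorem norm_far_image_sum_le (N : ℕ) {x : ℝ} (hx : A N < x / Real.sqrt 2) {T : ℂ}
    (hT : HasSum (fun n : ℕ => (-1 : ℂ) ^ (n + 1) * Complex.exp (-(A N * (n + 1)) ^ 2) *
        (gaussLaplace (ray x - A N * (n + 1)) + gaussLaplace (ray x + A N * (n + 1)))) T) :
    ‖T‖ ≤ 2 * (x / Real.sqrt 2) / ((x / Real.sqrt 2) ^ 2 - A N ^ 2) * Real.exp (-(A N) ^ 2) /
      (1 - Real.exp (-2 * A N ^ 2)) := by
  have hA := A_pos N
  set a := x / Real.sqrt 2 with ha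
  refine norm_le_of_hasSum_geometric hT (Real.exp_pos _).le (exp_neg_two_A_sq_lt_one N)
    fun n => ?_
  have hre1 : (ray x - A N * (n + 1)).re = a - A N * (n + 1) := by
    rw [Complex.sub_re, ray_re, show (A N * (n + 1) : ℂ) = ((A N * (n + 1) : ℝ) : ℂ) by
      push_cast; rfl, Complex.ofReal_re]
  have hre2 : (ray x + A N * (n + 1)).re = a + A N * (n + 1) := by
    rw [Complex.add_re, ray_re, show (A N * (n + 1) : ℂ) = ((A N * (n + 1) : ℝ) : ℂ) by
      push_cast; rfl, Complex.ofReal_re]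
  have hAn : A N ≤ A N * (n + 1) := by
    have : (0 : ℝ) ≤ n := Nat.cast_nonneg n
    nlinarith
  have h1 := norm_gaussLaplace_le (ray x - A N * (n + 1)) (b := a - A N) (by linarith)
  have h2 := norm_gaussLaplace_le_one_div (q := ray x + A N * (n + 1)) (by rw [hre2]; linarith)
  rw [hre1] at h1
  rw [hre2] at h2
  have h3 : 1 / (a + A N * (n + 1)) ≤ 1 / (a + A N) := by
    apply one_div_le_one_div_of_le <;> linarith
  have h4 := exp_neg_sq_le N n
  have h5 : Real.exp (-(A N * (n + 1)) ^ 2) * Real.exp ((a - A N - (a - A N * (n + 1))) ^ 2) =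
      Real.exp (-(A N) ^ 2) * Real.exp (-2 * A N ^ 2) ^ n := by
    rw [← Real.exp_nat_mul, ← Real.exp_add, ← Real.exp_add]
    congr 1
    ring
  rw [norm_mul, norm_mul, norm_pow, norm_neg, norm_one, one_pow, one_mul, norm_exp_neg_sq]
  have hd1 : a - A N ≠ 0 := by linarith
  have hd2 : a + A N ≠ 0 := by linarith
  have hd3 : a ^ 2 - A N ^ 2 = (a - A N) * (a + A N) := by ring
  calc _ ≤ Real.exp (-(A N * (n + 1)) ^ 2) *
        (Real.exp ((a - A N - (a - A N * (n + 1))) ^ 2) / (a - A N) + 1 / (a + A N)) := by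
        gcongr
        exact (norm_add_le _ _).trans (by linarith)
    _ = Real.exp (-(A N) ^ 2) * Real.exp (-2 * A N ^ 2) ^ n / (a - A N) +
        Real.exp (-(A N * (n + 1)) ^ 2) * (1 / (a + A N)) := by
        rw [mul_add, ← mul_div_assoc, h5]
    _ ≤ Real.exp (-(A N) ^ 2) * Real.exp (-2 * A N ^ 2) ^ n / (a - A N) +
        Real.exp (-(A N) ^ 2) * Real.exp (-2 * A N ^ 2) ^ n * (1 / (a + A N)) := by
        have : 0 ≤ 1 / (a + A N) := by apply one_div_nonneg.2; linarith
        gcongr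
    _ = _ := by
        rw [hd3]
        field_simp
        ring

theorem one_div_one_sub_exp_neg_two_pi_le :
    1 / (1 - Real.exp (-(2 * Real.pi))) ≤ (2 * Real.pi + 1) / (2 * Real.pi) := by
  have hπ := Real.pi_pos
  have h1 := Real.add_one_le_exp (2 * Real.pi)
  have h2 : 1 - Real.exp (-(2 * Real.pi)) ≥ 1 - 1 / (2 * Real.pi + 1) := by
    rw [Real.exp_neg, ← one_div]
    have : 1 / Real.exp (2 * Real.pi) ≤ 1 / (2 * Real.pi + 1) :=
      one_div_le_one_div_of_le (by positivity) h1
    linarith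
  have h3 : 1 - 1 / (2 * Real.pi + 1) = 2 * Real.pi / (2 * Real.pi + 1) := by field_simp; ring
  rw [h3] at h2
  calc _ ≤ 1 / (2 * Real.pi / (2 * Real.pi + 1)) := one_div_le_one_div_of_le (by positivity) h2
    _ = _ := by rw [one_div_div]

/-- The first node left out is `t_{N+1} = A_N`, and `t_{N+1+m}² ≥ A_N² + 2 π m`. -/
theorem norm_quadTerm_le (N : ℕ) {x : ℝ} (hx : 0 ≤ x) (m : ℕ) :
    ‖quadTerm N x (m + N)‖ ≤ x / (A N * Real.sqrt (x ^ 4 + A N ^ 4)) * Real.exp (-(A N) ^ 2) *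
      Real.exp (-(2 * Real.pi)) ^ m := by
  have hA := A_pos N
  have hπ := Real.pi_pos
  have hAs := A_sq N
  have ht : node N (m + N + 1) = A N + m * Real.pi / A N := by
    have h : (A N + m * Real.pi / A N) * A N = A N ^ 2 + m * Real.pi := by field_simp
    rw [node_succ, div_eq_iff hA.ne', h, hAs]
    push_cast
    ring
  have htA : A N ≤ node N (m + N + 1) := by rw [ht]; linarith [show 0 ≤ m * Real.pi / A N by positivity]
  have ht2 : A N ^ 2 + 2 * Real.pi * m ≤ node N (m + N + 1) ^ 2 := by
    rw [ht]
    have : (A N + m * Real.pi / A N) ^ 2 =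
        A N ^ 2 + 2 * Real.pi * m + (m * Real.pi / A N) ^ 2 := by
      field_simp; ring
    rw [this]
    linarith [sq_nonneg (m * Real.pi / A N)]
  rw [quadTerm]
  set t := node N (m + N + 1)
  have h1 : ‖Complex.exp (Complex.I * ((x : ℂ) ^ 2 + Real.pi / 4))‖ = 1 := by
    rw [show Complex.I * ((x : ℂ) ^ 2 + Real.pi / 4) = ((x ^ 2 + Real.pi / 4 : ℝ) : ℂ) * Complex.I by
      push_cast; ring, Complex.norm_exp_ofReal_mul_I]
  have h2 : ‖Complex.exp (-(t : ℂ) ^ 2)‖ = Real.exp (-t ^ 2) := by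
    rw [show Complex.exp (-(t : ℂ) ^ 2) = (Real.exp (-t ^ 2) : ℝ) by push_cast; rfl,
      Complex.norm_real, Real.norm_of_nonneg (Real.exp_pos _).le]
  have h3 : ‖(x : ℂ) ^ 2 + Complex.I * (t : ℂ) ^ 2‖ = Real.sqrt (x ^ 4 + t ^ 4) := by
    rw [show (x : ℂ) ^ 2 + Complex.I * (t : ℂ) ^ 2 = ((x ^ 2 : ℝ) : ℂ) + ((t ^ 2 : ℝ) : ℂ) * Complex.I
      by push_cast; ring, Complex.norm_add_mul_I]
    congr 1
    ring
  have h4 : Real.exp (-t ^ 2) ≤ Real.exp (-(A N) ^ 2) * Real.exp (-(2 * Real.pi)) ^ m := by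
    rw [← Real.exp_nat_mul, ← Real.exp_add]
    apply Real.exp_le_exp.2
    linarith
  have h5 : Real.sqrt (x ^ 4 + A N ^ 4) ≤ Real.sqrt (x ^ 4 + t ^ 4) := by gcongr
  have h6 : 0 < Real.sqrt (x ^ 4 + A N ^ 4) := by positivity
  rw [norm_mul, norm_mul, norm_div, norm_div, h1, h2, h3, Complex.norm_real, Complex.norm_real,
    Real.norm_of_nonneg hx, Real.norm_of_nonneg hA.le]
  calc _ ≤ x / A N * 1 * (Real.exp (-(A N) ^ 2) * Real.exp (-(2 * Real.pi)) ^ m /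
        Real.sqrt (x ^ 4 + A N ^ 4)) := by gcongr
    _ = _ := by field_simp

theorem norm_tail_le (N : ℕ) {x : ℝ} (hx : 0 ≤ x) {e : ℂ}
    (he : HasSum (fun m => quadTerm N x (m + N)) e) :
    ‖e‖ ≤ (2 * Real.pi + 1) * x / (2 * Real.pi * A N * Real.sqrt (x ^ 4 + (A N) ^ 4)) *
      Real.exp (-(A N) ^ 2) := by
  have hA := A_pos N
  have hπ := Real.pi_pos
  have h6 : 0 < Real.sqrt (x ^ 4 + A N ^ 4) := by positivity
  have h := norm_le_of_hasSum_geometric he (Real.exp_pos (-(2 * Real.pi))).le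
    (Real.exp_lt_one_iff.2 (by linarith)) (norm_quadTerm_le N hx)
  refine h.trans ?_
  rw [div_eq_mul_one_div]
  calc _ ≤ x / (A N * Real.sqrt (x ^ 4 + A N ^ 4)) * Real.exp (-(A N) ^ 2) *
        ((2 * Real.pi + 1) / (2 * Real.pi)) :=
        mul_le_mul_of_nonneg_left one_div_one_sub_exp_neg_two_pi_le (by positivity)
    _ = _ := by field_simp

/-- The three estimates of the untruncated error, one for each case of `Δ`. -/
theorem norm_error_le_Δ (N : ℕ) {x : ℝ} (hx : 0 < x) {T : ℂ}
    (hT : HasSum (fun n : ℕ => (-1 : ℂ) ^ (n + 1) * Complex.exp (-(A N * (n + 1)) ^ 2) *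
        (gaussLaplace (ray x - A N * (n + 1)) + gaussLaplace (ray x + A N * (n + 1)))) T) :
    ‖-(Complex.exp (-ray x ^ 2) / (2 * (Real.sqrt Real.pi : ℂ)) * T) -
          1 / (1 + Complex.exp (2 * (A N * ray x)))‖ ≤ Δ N x := by
  have hA := A_pos N
  have hs2 : 0 < Real.sqrt 2 := by positivity
  have hs2' : Real.sqrt 2 ^ 2 = 2 := Real.sq_sqrt (by norm_num)
  have hsp : 0 < Real.sqrt Real.pi := Real.sqrt_pos.2 Real.pi_pos
  have hD : 0 < 1 - Real.exp (-2 * A N ^ 2) := by linarith [exp_neg_two_A_sq_lt_one N]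
  have href := hasSum_error_of_reflection N hx hT
  have hxa : x = Real.sqrt 2 * (x / Real.sqrt 2) := by field_simp
  have hx2 : x ^ 2 / 2 = (x / Real.sqrt 2) ^ 2 := by rw [div_pow, hs2']
  have hge : ∀ n : ℕ, A N ≤ A N * (n + 1) := fun n => by
    have : (0 : ℝ) ≤ n := Nat.cast_nonneg n
    nlinarith
  have ha0 : 0 < x / Real.sqrt 2 := by positivity
  rw [Δ]
  split_ifs with h1 h2
  · rw [hx2]
    have hlt : x / Real.sqrt 2 < A N := by linarith
    have hd : 0 < A N ^ 2 - (x / Real.sqrt 2) ^ 2 := by nlinarith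
    refine (norm_le_of_forall_norm_gaussLaplace_sub_le N x href
      (M := 2 * Real.sqrt 2 * (x / Real.sqrt 2) / (A N ^ 2 - (x / Real.sqrt 2) ^ 2))
      fun n => ?_).trans (le_of_eq ?_)
    · refine (norm_gaussLaplace_sub_ray_le N n hx.le (hlt.trans_le (hge n))).trans ?_
      have := hge n
      gcongr
    · field_simp
  · rw [not_le] at h1
    have hM : ∀ n : ℕ, ‖gaussLaplace (A N * (n + 1) - ray x) -
        gaussLaplace (A N * (n + 1) + ray x)‖ ≤
        8 * Real.sqrt 2 * (x / Real.sqrt 2) / (A N * (A N + x / Real.sqrt 2)) := by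
      intro n
      rcases n with _ | n
      · have := norm_gaussLaplace_near_le hA h1
        simpa [ray] using this
      · have hn : A N * 2 ≤ A N * (((n + 1 : ℕ) : ℝ) + 1) := by
          have : (0 : ℝ) ≤ n := Nat.cast_nonneg n
          push_cast
          nlinarith
        refine (norm_gaussLaplace_sub_ray_le N (n + 1) hx.le (by linarith)).trans ?_
        have hsq : (A N * 2) ^ 2 ≤ (A N * (((n + 1 : ℕ) : ℝ) + 1)) ^ 2 := by gcongr
        have hpos : A N * (A N + x / Real.sqrt 2) ≤
            4 * ((A N * (((n + 1 : ℕ) : ℝ) + 1)) ^ 2 - (x / Real.sqrt 2) ^ 2) := by nlinarith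
        rw [div_le_div_iff₀ (by nlinarith) (by positivity)]
        calc _ ≤ 2 * Real.sqrt 2 * (x / Real.sqrt 2) *
              (4 * ((A N * (((n + 1 : ℕ) : ℝ) + 1)) ^ 2 - (x / Real.sqrt 2) ^ 2)) := by gcongr
          _ = _ := by ring
    refine (norm_le_of_forall_norm_gaussLaplace_sub_le N x href hM).trans ?_
    have h3 : (1 : ℝ) ≤ 1 + 2 * Real.sqrt Real.pi * Real.exp (-β * A N ^ 2) := by
      have := Real.exp_pos (-β * A N ^ 2)
      have : 0 ≤ 2 * Real.sqrt Real.pi * Real.exp (-β * A N ^ 2) := by positivity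
      linarith
    calc _ = 4 * x * Real.exp (-(A N) ^ 2) * 1 /
          (Real.sqrt Real.pi * A N * (A N + x / Real.sqrt 2) * (1 - Real.exp (-2 * (A N) ^ 2))) := by
          field_simp
          ring
      _ ≤ _ := by gcongr
  · rw [not_lt] at h2
    have hT' := norm_far_image_sum_le N (x := x) (by linarith) hT
    have hre : (2 * (A N * ray x)).re = Real.sqrt 2 * A N * x := by
      rw [show (2 * (A N * ray x) : ℂ) = ((2 * A N : ℝ) : ℂ) * ray x by push_cast; ring,
        Complex.re_ofReal_mul, ray_re]
      field_simp
      rw [hs2']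
    have hw : 0 < (2 * (A N * ray x)).re := by rw [hre]; positivity
    have h3 := norm_inv_one_add_exp_le hw
    rw [hre] at h3
    refine (norm_sub_le _ _).trans (add_le_add ?_ h3)
    rw [norm_neg, norm_mul, norm_prefactor]
    have hd : 0 < (x / Real.sqrt 2) ^ 2 - A N ^ 2 := by nlinarith
    rw [hx2]
    calc _ ≤ 1 / (2 * Real.sqrt Real.pi) * (2 * (x / Real.sqrt 2) /
          ((x / Real.sqrt 2) ^ 2 - A N ^ 2) * Real.exp (-(A N) ^ 2) /
          (1 - Real.exp (-2 * A N ^ 2))) := by gcongr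
      _ = (x / Real.sqrt 2) * Real.exp (-(A N) ^ 2) /
          (Real.sqrt Real.pi * ((x / Real.sqrt 2) ^ 2 - A N ^ 2) *
            (1 - Real.exp (-2 * A N ^ 2))) := by
          field_simp
      _ ≤ _ := by
          gcongr
          exact div_le_self hx.le (Real.one_le_sqrt.2 (by norm_num))

theorem norm_F_sub_approxF_le_of_pos (N : ℕ) {x : ℝ} (hx : 0 < x) :
    ‖F x - approxF N x‖ ≤ η N x := by
  obtain ⟨T, hT, ht⟩ := exists_error_eq N hx
  have h1 := norm_error_le_Δ N hx hT
  have h2 := norm_tail_le N hx.le ht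
  rw [η, abs_of_pos hx]
  have h3 := norm_add_le (F x - approxF N x - (-(Complex.exp (-ray x ^ 2) /
    (2 * (Real.sqrt Real.pi : ℂ)) * T) - 1 / (1 + Complex.exp (2 * (A N * ray x)))))
    (-(Complex.exp (-ray x ^ 2) / (2 * (Real.sqrt Real.pi : ℂ)) * T) -
          1 / (1 + Complex.exp (2 * (A N * ray x))))
  rw [sub_add_cancel] at h3
  linarith

theorem η_neg (N : ℕ) (x : ℝ) : η N (-x) = η N x := by
  rw [η, η, abs_neg, Even.neg_pow (by decide)]

theorem norm_F_sub_approxF_le (N : ℕ) (x : ℝ) : ‖F x - approxF N x‖ ≤ η N x := by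
  rcases lt_trichotomy x 0 with hx | hx | hx
  · have h := norm_F_sub_approxF_le_of_pos N (neg_pos.2 hx)
    rw [F_neg, approxF_neg, η_neg, sub_sub_sub_cancel_left, norm_sub_rev] at h
    exact h
  · have h := F_neg 0
    rw [neg_zero] at h
    have h1 : F 0 = 1 / 2 := by linear_combination h / 2
    have h2 : approxF N 0 = 1 / 2 := by simp [approxF]
    have hA := A_pos N
    rw [hx, h1, h2, η, Δ]
    simp [hA.le]
  · exact norm_F_sub_approxF_le_of_pos N hx

/-! ### A lower bound for the Fresnel integral -/

theorem integral_exp_neg_sq_mul_exp (s : ℝ) :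
    ∫ t : ℝ, Complex.exp (-(t : ℂ) ^ 2) * Complex.exp (-(Complex.I * t) * s) =
      (Real.sqrt Real.pi : ℂ) * Complex.exp (-(s : ℂ) ^ 2 / 4) := by
  have h := fourierIntegral_gaussian (b := 1) (by simp) (-s)
  have e : (Real.pi / 1 : ℂ) ^ (1 / 2 : ℂ) = (Real.sqrt Real.pi : ℂ) := by
    rw [div_one, show (1 / 2 : ℂ) = ((1 / 2 : ℝ) : ℂ) by push_cast; rfl,
      ← Complex.ofReal_cpow Real.pi_pos.le, ← Real.sqrt_eq_rpow]
  rw [e, neg_sq, mul_one] at h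
  rw [← h]
  congr 1
  ext t
  rw [mul_comm]
  congr 2 <;> ring

theorem integrable_exp_neg_sq : Integrable (fun t : ℝ => Complex.exp (-(t : ℂ) ^ 2)) := by
  have := integrable_cexp_neg_mul_sq (b := 1) (by simp)
  simpa using this

/-- Fubini, after writing `√π e^{-s² / 4}` as the Fourier transform of `e^{-t²}`. -/
theorem sqrt_pi_mul_gaussLaplace {p : ℂ} (hp : 0 < p.re) :
    (Real.sqrt Real.pi : ℂ) * gaussLaplace p =
      ∫ t : ℝ, Complex.exp (-(t : ℂ) ^ 2) / (p + Complex.I * t) := by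
  have hI : ∀ t : ℝ, (Complex.I * t).re = 0 := fun t => by simp
  have hint : Integrable (Function.uncurry fun (s t : ℝ) => Complex.exp (-p * s) *
      (Complex.exp (-(t : ℂ) ^ 2) * Complex.exp (-(Complex.I * t) * s)))
      ((volume.restrict (Ioi (0 : ℝ))).prod volume) := by
    have h1 : Integrable (fun z : ℝ × ℝ => Complex.exp (-p * z.1) * Complex.exp (-(z.2 : ℂ) ^ 2))
        ((volume.restrict (Ioi (0 : ℝ))).prod volume) :=
      Integrable.mul_prod (integrableOn_exp_mul_complex_Ioi (by simpa using hp) 0)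
        integrable_exp_neg_sq
    refine h1.norm.mono' (Continuous.aestronglyMeasurable (by fun_prop))
      (Eventually.of_forall fun z => ?_)
    simp only [Function.uncurry]
    rw [← mul_assoc, norm_mul _ (Complex.exp (-(Complex.I * z.2) * z.1)),
      Complex.norm_exp (-(Complex.I * z.2) * z.1),
      Complex.re_mul_ofReal, Complex.neg_re, hI]
    simp
  have hswap := integral_integral_swap hint
  have e1 : ∀ s : ℝ, ∫ t : ℝ, Complex.exp (-p * s) *
      (Complex.exp (-(t : ℂ) ^ 2) * Complex.exp (-(Complex.I * t) * s)) =
      (Real.sqrt Real.pi : ℂ) * Complex.exp (-p * s - (s : ℂ) ^ 2 / 4) := by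
    intro s
    rw [integral_const_mul, integral_exp_neg_sq_mul_exp, mul_left_comm, ← Complex.exp_add]
    congr 2
    ring
  have e2 : ∀ t : ℝ, ∫ s in Ioi (0 : ℝ), Complex.exp (-p * s) *
      (Complex.exp (-(t : ℂ) ^ 2) * Complex.exp (-(Complex.I * t) * s)) =
      Complex.exp (-(t : ℂ) ^ 2) / (p + Complex.I * t) := fun t =>
    (integral_exp_mul_const_mul_exp p _ _ hp (hI t)).2.1
  simp only [e1, e2] at hswap
  rw [integral_const_mul] at hswap
  exact hswap

theorem norm_add_I_mul_ge {p : ℂ} (t : ℝ) : p.re ≤ ‖p + Complex.I * t‖ := by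
  have := (le_abs_self _).trans (Complex.abs_re_le_norm (p + Complex.I * t))
  simpa using this

theorem integrable_exp_neg_sq_div {p : ℂ} (hp : 0 < p.re) :
    Integrable (fun t : ℝ => Complex.exp (-(t : ℂ) ^ 2) / (p + Complex.I * t)) := by
  have h1 : Continuous fun t : ℝ => Complex.exp (-(t : ℂ) ^ 2) / (p + Complex.I * t) :=
    Continuous.div (by fun_prop) (by fun_prop) fun t => add_I_mul_ofReal_ne_zero hp t
  refine (integrable_exp_neg_sq.norm.div_const p.re).mono' h1.aestronglyMeasurable
    (Eventually.of_forall fun t => ?_)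
  rw [norm_div]
  have := norm_add_I_mul_ge (p := p) t
  gcongr

/-- The even part of the integrand in `sqrt_pi_mul_gaussLaplace`. -/
theorem sqrt_pi_mul_gaussLaplace_eq_even {p : ℂ} (hp : 0 < p.re) :
    (Real.sqrt Real.pi : ℂ) * gaussLaplace p =
      ∫ t : ℝ, Complex.exp (-(t : ℂ) ^ 2) * (p / (p ^ 2 + (t : ℂ) ^ 2)) := by
  have h := integrable_exp_neg_sq_div hp
  have h0 := sqrt_pi_mul_gaussLaplace hp
  have h1 := integral_neg_eq_self
    (fun t : ℝ => Complex.exp (-(t : ℂ) ^ 2) / (p + Complex.I * t)) volume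
  have h2 := integral_add h h.comp_neg
  rw [h1, ← h0] at h2
  have e : ∀ t : ℝ, Complex.exp (-(t : ℂ) ^ 2) / (p + Complex.I * t) +
      Complex.exp (-((-t : ℝ) : ℂ) ^ 2) / (p + Complex.I * (-t : ℝ)) =
      2 * (Complex.exp (-(t : ℂ) ^ 2) * (p / (p ^ 2 + (t : ℂ) ^ 2))) := by
    intro t
    have n1 := add_I_mul_ofReal_ne_zero hp t
    have n2 := add_I_mul_ofReal_ne_zero hp (-t)
    have n3 := sq_add_sq_ne_zero hp t
    have n4 : (p + Complex.I * t) * (p + Complex.I * (-t : ℝ)) = p ^ 2 + (t : ℂ) ^ 2 := by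
      push_cast
      linear_combination (-(t : ℂ) ^ 2) * Complex.I_sq
    rw [div_add_div _ _ n1 n2, n4]
    push_cast
    rw [neg_sq]
    field_simp
    ring
  simp only [e] at h2
  rw [integral_const_mul] at h2
  linear_combination -h2 / 2

/-- The rotated function `e^{iπ/4} K(e^{-iπ/4} x)`, whose real and imaginary parts are positive for
`x > 0`. -/
noncomputable def rotatedGaussLaplace (x : ℝ) : ℂ :=
  Complex.exp (Complex.I * (Real.pi / 4)) * gaussLaplace (ray x)

theorem norm_rotatedGaussLaplace (x : ℝ) : ‖rotatedGaussLaplace x‖ = ‖gaussLaplace (ray x)‖ := by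
  rw [rotatedGaussLaplace, norm_mul, show Complex.I * (Real.pi / 4 : ℂ) =
    ((Real.pi / 4 : ℝ) : ℂ) * Complex.I by push_cast; ring, Complex.norm_exp_ofReal_mul_I, one_mul]

theorem exp_mul_ray (x : ℝ) : Complex.exp (Complex.I * (Real.pi / 4)) * ray x = x := by
  rw [ray_eq, ← mul_assoc, ← Complex.exp_add]
  simp

theorem integrable_exp_neg_sq_div_quartic {x : ℝ} (hx : 0 < x) :
    Integrable (fun t : ℝ => Real.exp (-t ^ 2) / (x ^ 4 + t ^ 4)) ∧
    Integrable (fun t : ℝ => Real.exp (-t ^ 2) * t ^ 2 / (x ^ 4 + t ^ 4)) := by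
  have hne : ∀ t : ℝ, x ^ 4 + t ^ 4 ≠ 0 := fun t => by positivity
  have hi : Integrable (fun t : ℝ => Real.exp (-t ^ 2)) := by
    simpa using integrable_exp_neg_mul_sq (b := 1) one_pos
  constructor
  · refine (hi.div_const (x ^ 4)).mono' (Continuous.aestronglyMeasurable
      (Continuous.div (by fun_prop) (by fun_prop) hne)) (Eventually.of_forall fun t => ?_)
    rw [Real.norm_of_nonneg (by positivity)]
    gcongr
    linarith [show 0 ≤ t ^ 4 by positivity]
  · refine (hi.div_const (x ^ 2)).mono' (Continuous.aestronglyMeasurable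
      (Continuous.div (by fun_prop) (by fun_prop) hne)) (Eventually.of_forall fun t => ?_)
    rw [Real.norm_of_nonneg (by positivity), mul_div_assoc, div_eq_mul_one_div (Real.exp _) (x ^ 2)]
    refine mul_le_mul_of_nonneg_left ?_ (Real.exp_pos _).le
    rw [div_le_div_iff₀ (by positivity) (by positivity)]
    nlinarith [sq_nonneg (x ^ 2 - t ^ 2), sq_nonneg (x ^ 2), sq_nonneg (t ^ 2),
      mul_nonneg (sq_nonneg x) (sq_nonneg t)]

theorem rotatedGaussLaplace_eq {x : ℝ} (hx : 0 < x) :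
    (Real.sqrt Real.pi : ℂ) * rotatedGaussLaplace x =
      ((x * ∫ t : ℝ, Real.exp (-t ^ 2) * t ^ 2 / (x ^ 4 + t ^ 4) : ℝ) : ℂ) +
      ((x ^ 3 * ∫ t : ℝ, Real.exp (-t ^ 2) / (x ^ 4 + t ^ 4) : ℝ) : ℂ) * Complex.I := by
  obtain ⟨h1, h2⟩ := integrable_exp_neg_sq_div_quartic hx
  have h := sqrt_pi_mul_gaussLaplace_eq_even (ray_re_pos hx)
  rw [rotatedGaussLaplace, mul_left_comm, h, ← integral_const_mul, ← integral_const_mul,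
    ← integral_const_mul, ← integral_complex_ofReal, ← integral_complex_ofReal,
    ← integral_mul_const, ← integral_add (h2.const_mul x).ofReal
      ((h1.const_mul (x ^ 3)).ofReal.mul_const _)]
  congr 1
  ext t
  have hne : ((x : ℂ) ^ 4 + (t : ℂ) ^ 4) ≠ 0 := by
    exact_mod_cast (by positivity : x ^ 4 + t ^ 4 ≠ 0)
  have hn1 := sq_add_sq_ne_zero (ray_re_pos hx) t
  have e1 : Complex.exp (-(t : ℂ) ^ 2) = (Real.exp (-t ^ 2) : ℝ) := by push_cast; rfl
  have e2 : Complex.exp (Complex.I * (Real.pi / 4)) * (Complex.exp (-(t : ℂ) ^ 2) *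
      (ray x / (ray x ^ 2 + (t : ℂ) ^ 2))) =
      Complex.exp (-(t : ℂ) ^ 2) * (x / (ray x ^ 2 + (t : ℂ) ^ 2)) := by
    linear_combination Complex.exp (-(t : ℂ) ^ 2) / (ray x ^ 2 + (t : ℂ) ^ 2) * exp_mul_ray x
  have e3 : (x : ℂ) / (ray x ^ 2 + (t : ℂ) ^ 2) =
      (x * t ^ 2 + x ^ 3 * Complex.I) / (x ^ 4 + (t : ℂ) ^ 4) := by
    rw [div_eq_div_iff hn1 hne, ray_sq]
    linear_combination (x : ℂ) ^ 5 * Complex.I_sq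
  rw [e2, e3, e1]
  push_cast
  field_simp

theorem im_rotatedGaussLaplace {x : ℝ} (hx : 0 < x) :
    Real.sqrt Real.pi * (rotatedGaussLaplace x).im =
      x ^ 3 * ∫ t : ℝ, Real.exp (-t ^ 2) / (x ^ 4 + t ^ 4) := by
  have h := congrArg Complex.im (rotatedGaussLaplace_eq hx)
  rw [Complex.im_ofReal_mul] at h
  rw [h, Complex.add_im, Complex.ofReal_im, Complex.im_ofReal_mul, Complex.I_im]
  ring

theorem im_rotatedGaussLaplace_nonneg {x : ℝ} (hx : 0 < x) : 0 ≤ (rotatedGaussLaplace x).im := by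
  have hp : 0 < Real.sqrt Real.pi := Real.sqrt_pos.2 Real.pi_pos
  refine nonneg_of_mul_nonneg_right ?_ hp
  rw [im_rotatedGaussLaplace hx]
  exact mul_nonneg (by positivity) (integral_nonneg fun t => by positivity)

theorem integral_exp_neg_sq : ∫ t : ℝ, Real.exp (-t ^ 2) = Real.sqrt Real.pi := by
  simpa using integral_gaussian 1

theorem integral_pow_four_mul_exp_neg_sq :
    ∫ t : ℝ, t ^ 4 * Real.exp (-t ^ 2) = 3 / 4 * Real.sqrt Real.pi := by
  have h1 := integral_comp_abs (f := fun t : ℝ => t ^ 4 * Real.exp (-t ^ 2))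
  have h2 := integral_rpow_mul_exp_neg_rpow (p := 2) (q := 4) (by norm_num) (by norm_num)
  have e : ∀ t : ℝ, |t| ^ 4 * Real.exp (-|t| ^ 2) = t ^ 4 * Real.exp (-t ^ 2) := fun t => by
    rw [sq_abs, Even.pow_abs (by decide)]
  have hG : Real.Gamma ((4 + 1) / 2) = 3 / 4 * Real.sqrt Real.pi := by
    rw [show ((4 : ℝ) + 1) / 2 = (1 / 2 + 1) + 1 by norm_num, Real.Gamma_add_one (by norm_num),
      Real.Gamma_add_one (by norm_num), Real.Gamma_one_half_eq]
    ring
  simp only [e] at h1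
  rw [h1]
  rw [hG] at h2
  have e2 : ∫ t in Ioi (0 : ℝ), t ^ 4 * Real.exp (-t ^ 2) =
      ∫ x in Ioi (0 : ℝ), x ^ (4 : ℝ) * Real.exp (-x ^ (2 : ℝ)) := by
    congr 1
    ext t
    norm_cast
  rw [e2, h2]
  ring

theorem integrable_pow_four_mul_exp_neg_sq :
    Integrable fun t : ℝ => t ^ 4 * Real.exp (-t ^ 2) := by
  by_contra h
  have h1 := integral_pow_four_mul_exp_neg_sq
  rw [integral_undef h] at h1
  have : 0 < Real.sqrt Real.pi := Real.sqrt_pos.2 Real.pi_pos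
  linarith

/-- Jensen's inequality for `v ↦ 1 / v`, in the form of its tangent line at `u = x⁴ + 3 / 4`, the mean of
`x⁴ + t⁴` under the density `e^{-t²} / √π`. -/
theorem le_im_rotatedGaussLaplace {x : ℝ} (hx : 0 < x) :
    x ^ 3 / (x ^ 4 + 3 / 4) ≤ (rotatedGaussLaplace x).im := by
  have hp : 0 < Real.sqrt Real.pi := Real.sqrt_pos.2 Real.pi_pos
  have h := im_rotatedGaussLaplace hx
  set u : ℝ := x ^ 4 + 3 / 4 with hu
  have hu0 : 0 < u := by positivity
  have hi : Integrable (fun t : ℝ => Real.exp (-t ^ 2)) := by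
    simpa using integrable_exp_neg_mul_sq (b := 1) one_pos
  have h1 : Real.sqrt Real.pi / u ≤ ∫ t : ℝ, Real.exp (-t ^ 2) / (x ^ 4 + t ^ 4) := by
    have h2 : ∫ t : ℝ, ((2 * u - x ^ 4) / u ^ 2 * Real.exp (-t ^ 2) -
        1 / u ^ 2 * (t ^ 4 * Real.exp (-t ^ 2))) = Real.sqrt Real.pi / u := by
      rw [integral_sub (hi.const_mul _) (integrable_pow_four_mul_exp_neg_sq.const_mul _),
        integral_const_mul, integral_const_mul, integral_exp_neg_sq,
        integral_pow_four_mul_exp_neg_sq]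
      field_simp
      rw [hu]
      ring
    rw [← h2]
    refine integral_mono ((hi.const_mul _).sub (integrable_pow_four_mul_exp_neg_sq.const_mul _))
      (integrable_exp_neg_sq_div_quartic hx).1 fun t => ?_
    have hv : 0 < x ^ 4 + t ^ 4 := by positivity
    have h3 : (2 * u - x ^ 4) / u ^ 2 - 1 / u ^ 2 * t ^ 4 ≤ 1 / (x ^ 4 + t ^ 4) := by
      rw [show (2 * u - x ^ 4) / u ^ 2 - 1 / u ^ 2 * t ^ 4 =
        (2 * u - (x ^ 4 + t ^ 4)) / u ^ 2 by ring, div_le_div_iff₀ (by positivity) hv]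
      nlinarith [sq_nonneg (u - (x ^ 4 + t ^ 4))]
    have := mul_le_mul_of_nonneg_right h3 (Real.exp_pos (-t ^ 2)).le
    dsimp only
    calc _ = ((2 * u - x ^ 4) / u ^ 2 - 1 / u ^ 2 * t ^ 4) * Real.exp (-t ^ 2) := by ring
      _ ≤ _ := this
      _ = _ := by ring
  have h4 : Real.sqrt Real.pi * (x ^ 3 / u) ≤ Real.sqrt Real.pi * (rotatedGaussLaplace x).im := by
    rw [h]
    calc _ = x ^ 3 * (Real.sqrt Real.pi / u) := by ring
      _ ≤ _ := by gcongr
  exact le_of_mul_le_mul_left h4 hp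

theorem hasDerivAt_rotatedGaussLaplace (x : ℝ) :
    HasDerivAt rotatedGaussLaplace (-2 * Complex.I * x * rotatedGaussLaplace x - 2) x := by
  have h2 : HasDerivAt (fun x => gaussLaplace (ray x)) _ x :=
    (hasDerivAt_gaussLaplace (ray x)).comp x (hasDerivAt_ray x)
  refine (h2.const_mul (Complex.exp (Complex.I * (Real.pi / 4)))).congr_deriv ?_
  have h3 : Complex.exp (Complex.I * (Real.pi / 4)) *
      Complex.exp (-(Complex.I * (Real.pi / 4))) = 1 := by rw [← Complex.exp_add]; simp
  have h4 : Complex.exp (-(Complex.I * (Real.pi / 4))) =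
      -Complex.I * Complex.exp (Complex.I * (Real.pi / 4)) := by
    have h : -Complex.I = Complex.exp (-Real.pi / 2 * Complex.I) := Complex.exp_neg_pi_div_two_mul_I.symm
    rw [h, ← Complex.exp_add]
    congr 1
    ring
  rw [rotatedGaussLaplace]
  linear_combination (2 * ray x * gaussLaplace (ray x) - 2) * h3 + 2 * gaussLaplace (ray x) * ray_eq x +
    2 * gaussLaplace (ray x) * x * h4

theorem hasDerivAt_re_im_rotatedGaussLaplace (x : ℝ) :
    HasDerivAt (fun x => (rotatedGaussLaplace x).re) (2 * x * (rotatedGaussLaplace x).im - 2) x ∧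
    HasDerivAt (fun x => (rotatedGaussLaplace x).im) (-2 * x * (rotatedGaussLaplace x).re) x := by
  have h := hasDerivAt_rotatedGaussLaplace x
  constructor
  · have := (Complex.reCLM.hasFDerivAt.comp_hasDerivAt x h)
    refine this.congr_deriv ?_
    simp
  · have := (Complex.imCLM.hasFDerivAt.comp_hasDerivAt x h)
    refine this.congr_deriv ?_
    simp

theorem nonneg_of_hasDerivAt_nonneg {h h' : ℝ → ℝ} (hd : ∀ x, HasDerivAt h (h' x) x)
    (h0 : 0 ≤ h 0) (hpos : ∀ x, 0 < x → 0 ≤ h' x) {x : ℝ} (hx : 0 ≤ x) : 0 ≤ h x := by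
  have hm : MonotoneOn h (Ici 0) := by
    refine monotoneOn_of_deriv_nonneg (convex_Ici 0)
      (fun y _ => (hd y).continuousAt.continuousWithinAt)
      (fun y _ => (hd y).differentiableAt.differentiableWithinAt) fun y hy => ?_
    rw [interior_Ici] at hy
    rw [(hd y).deriv]
    exact hpos y hy
  exact h0.trans (hm (self_mem_Ici) hx hx)

theorem re_im_rotatedGaussLaplace_zero :
    (rotatedGaussLaplace 0).re = Real.sqrt (Real.pi / 2) ∧
    (rotatedGaussLaplace 0).im = Real.sqrt (Real.pi / 2) := by
  have h0 : ray 0 = 0 := by simp [ray]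
  have h2 : Real.sqrt 2 ^ 2 = 2 := Real.sq_sqrt (by norm_num)
  have h3 : Real.sqrt 2 ≠ 0 := by positivity
  have e : Complex.exp (Complex.I * (Real.pi / 4)) =
      ((Real.sqrt 2 / 2 : ℝ) : ℂ) + ((Real.sqrt 2 / 2 : ℝ) : ℂ) * Complex.I := by
    rw [show Complex.I * (Real.pi / 4 : ℂ) = ((Real.pi / 4 : ℝ) : ℂ) * Complex.I by push_cast; ring,
      Complex.exp_mul_I, ← Complex.ofReal_cos, ← Complex.ofReal_sin, Real.cos_pi_div_four,
      Real.sin_pi_div_four]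
  have h4 : Real.sqrt 2 / 2 * Real.sqrt Real.pi = Real.sqrt (Real.pi / 2) := by
    rw [Real.sqrt_div Real.pi_pos.le]
    field_simp
    rw [h2]
  rw [rotatedGaussLaplace, h0, gaussLaplace_zero, e]
  constructor
  · rw [Complex.re_mul_ofReal]; simpa using h4
  · rw [Complex.im_mul_ofReal]; simpa using h4

/-- Integrating `f' = -2 x g`, `g' = 2 x f - 2` repeatedly, from `f ≥ 0` and `f(0) = g(0) = √(π / 2)`,
gives alternately lower and upper polynomial bounds; the last one is integrated in
`(f² + g²)' = -4 g`. -/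
theorem le_normSq_rotatedGaussLaplace {x : ℝ} (hx : 0 ≤ x) :
    Real.pi - 4 * (Real.sqrt (Real.pi / 2) * x - x ^ 2 + Real.sqrt (Real.pi / 2) * x ^ 3 / 3 -
      Real.sqrt (Real.pi / 2) * x ^ 5 / 10 + 4 * x ^ 6 / 45) ≤
      (rotatedGaussLaplace x).re ^ 2 + (rotatedGaussLaplace x).im ^ 2 := by
  obtain ⟨z1, z2⟩ := re_im_rotatedGaussLaplace_zero
  set c := Real.sqrt (Real.pi / 2) with hc
  have hc2 : c ^ 2 = Real.pi / 2 := Real.sq_sqrt (by have := Real.pi_pos; positivity)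
  set g := fun x => (rotatedGaussLaplace x).re with hg
  set f := fun x => (rotatedGaussLaplace x).im with hf
  have dg : ∀ x, HasDerivAt g (2 * x * f x - 2) x := fun x => (hasDerivAt_re_im_rotatedGaussLaplace x).1
  have df : ∀ x, HasDerivAt f (-2 * x * g x) x := fun x => (hasDerivAt_re_im_rotatedGaussLaplace x).2
  have pow : ∀ (n : ℕ) (x : ℝ), HasDerivAt (fun x : ℝ => x ^ n) (n * x ^ (n - 1)) x :=
    fun n x => hasDerivAt_pow n x
  -- Each of the following bounds is obtained by integrating the one before it.
  have s1 : ∀ x, 0 ≤ x → 0 ≤ g x - (c - 2 * x) := by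
    intro x hx
    refine nonneg_of_hasDerivAt_nonneg (h := fun x => g x - (c - 2 * x))
      (h' := fun x => 2 * x * f x - 2 - (0 - 2 * 1)) (fun x => ?_) ?_ (fun x hx => ?_) hx
    · exact (dg x).sub ((hasDerivAt_const x c).sub ((hasDerivAt_id x).const_mul 2))
    · simp only [hg, z1]; simp
    · have := im_rotatedGaussLaplace_nonneg hx
      have : 0 ≤ x * f x := mul_nonneg hx.le this
      linarith
  have s2 : ∀ x, 0 ≤ x → 0 ≤ (c - c * x ^ 2 + 4 / 3 * x ^ 3) - f x := by
    intro x hx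
    refine nonneg_of_hasDerivAt_nonneg (h := fun x => (c - c * x ^ 2 + 4 / 3 * x ^ 3) - f x)
      (h' := fun x => (0 - c * ((2 : ℕ) * x ^ (2 - 1)) + 4 / 3 * ((3 : ℕ) * x ^ (3 - 1))) -
        (-2 * x * g x)) (fun x => ?_) ?_ (fun x hx => ?_) hx
    · exact (((hasDerivAt_const x c).sub ((pow 2 x).const_mul c)).add
        ((pow 3 x).const_mul (4 / 3))).sub (df x)
    · simp only [hf, z2]; simp
    · have := mul_nonneg hx.le (s1 x hx.le)
      norm_num
      linarith
  have s3 : ∀ x, 0 ≤ x → 0 ≤ (c - 2 * x + c * x ^ 2 - c / 2 * x ^ 4 + 8 / 15 * x ^ 5) - g x := by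
    intro x hx
    refine nonneg_of_hasDerivAt_nonneg
      (h := fun x => (c - 2 * x + c * x ^ 2 - c / 2 * x ^ 4 + 8 / 15 * x ^ 5) - g x)
      (h' := fun x => (0 - 2 * 1 + c * ((2 : ℕ) * x ^ (2 - 1)) - c / 2 * ((4 : ℕ) * x ^ (4 - 1)) +
        8 / 15 * ((5 : ℕ) * x ^ (5 - 1))) - (2 * x * f x - 2)) (fun x => ?_) ?_ (fun x hx => ?_) hx
    · exact (((((hasDerivAt_const x c).sub ((hasDerivAt_id x).const_mul 2)).add
        ((pow 2 x).const_mul c)).sub ((pow 4 x).const_mul (c / 2))).add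
        ((pow 5 x).const_mul (8 / 15))).sub (dg x)
    · simp only [hg, z1]; simp
    · have := mul_nonneg hx.le (s2 x hx.le)
      norm_num
      linarith
  have s4 := nonneg_of_hasDerivAt_nonneg
      (h := fun x => (g x ^ 2 + f x ^ 2) - (Real.pi - 4 * (c * x - x ^ 2 + c / 3 * x ^ 3 -
        c / 10 * x ^ 5 + 4 / 45 * x ^ 6)))
      (h' := fun x => ((2 : ℕ) * g x ^ (2 - 1) * (2 * x * f x - 2) +
        (2 : ℕ) * f x ^ (2 - 1) * (-2 * x * g x)) -
        (0 - 4 * (c * 1 - ((2 : ℕ) * x ^ (2 - 1)) + c / 3 * ((3 : ℕ) * x ^ (3 - 1)) -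
        c / 10 * ((5 : ℕ) * x ^ (5 - 1)) + 4 / 45 * ((6 : ℕ) * x ^ (6 - 1)))))
      (fun x => ?_) ?_ (fun x hx => ?_) hx
  · simp only [hf, hg] at s4 ⊢
    linarith
  · have hP := (((((hasDerivAt_id x).const_mul c).sub (pow 2 x)).add
      ((pow 3 x).const_mul (c / 3))).sub ((pow 5 x).const_mul (c / 10))).add
      ((pow 6 x).const_mul (4 / 45))
    exact (((dg x).pow 2).add ((df x).pow 2)).sub
      ((hasDerivAt_const x Real.pi).sub (hP.const_mul 4))
  · simp only [hf, hg, z1, z2, hc2]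
    norm_num
  · have := s3 x hx.le
    norm_num
    linarith

/-- The difference of the two sides is a combination with positive coefficients of the Bernstein
polynomials of degree `7` on `[0, 11 / 10]`. -/
theorem quintic_mul_sq_le {x : ℝ} (h0 : 0 ≤ x) (h1 : x ≤ 11 / 10) :
    (1.2534 - x + 0.4178 * x ^ 2 - 0.1253 * x ^ 4 + 4 / 45 * x ^ 5) * (1 + 1.7725 * x) ^ 2 ≤
      2.7839 + 2.4672 * x := by
  have hy : 0 ≤ 11 / 10 - x := by linarith
  have k0 : 0 ≤ (11 / 10 - x) ^ 7 := by positivity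
  have k1 : 0 ≤ x * (11 / 10 - x) ^ 6 := by positivity
  have k2 : 0 ≤ x ^ 2 * (11 / 10 - x) ^ 5 := by positivity
  have k3 : 0 ≤ x ^ 3 * (11 / 10 - x) ^ 4 := by positivity
  have k4 : 0 ≤ x ^ 4 * (11 / 10 - x) ^ 3 := by positivity
  have k5 : 0 ≤ x ^ 5 * (11 / 10 - x) ^ 2 := by positivity
  have k6 : 0 ≤ x ^ 6 * (11 / 10 - x) := by positivity
  have k7 : 0 ≤ x ^ 7 := by positivity
  linarith

theorem sqrt_pi_bounds : 1.7724 ≤ Real.sqrt Real.pi ∧ Real.sqrt Real.pi ≤ 1.7725 := by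
  have h1 := Real.pi_gt_d4
  have h2 := Real.pi_lt_d4
  exact ⟨Real.le_sqrt_of_sq_le (by linarith), Real.sqrt_le_iff.2 ⟨by norm_num, by linarith⟩⟩

theorem sqrt_pi_half_bounds :
    1.2533 ≤ Real.sqrt (Real.pi / 2) ∧ Real.sqrt (Real.pi / 2) ≤ 1.2534 := by
  have h1 := Real.pi_gt_d6
  have h2 := Real.pi_lt_d6
  exact ⟨Real.le_sqrt_of_sq_le (by linarith), Real.sqrt_le_iff.2 ⟨by norm_num, by linarith⟩⟩

theorem le_norm_gaussLaplace_ray_of_le {x : ℝ} (hx : 0 ≤ x) (h1 : x ≤ 11 / 10) :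
    Real.sqrt Real.pi / (1 + Real.sqrt Real.pi * x) ≤ ‖gaussLaplace (ray x)‖ := by
  have h := le_normSq_rotatedGaussLaplace hx
  obtain ⟨r1, r2⟩ := sqrt_pi_bounds
  obtain ⟨c1, c2⟩ := sqrt_pi_half_bounds
  have hr : Real.sqrt Real.pi ^ 2 = Real.pi := Real.sq_sqrt Real.pi_pos.le
  have hp1 := Real.pi_gt_d4
  set r := Real.sqrt Real.pi
  set c := Real.sqrt (Real.pi / 2)
  rw [← norm_rotatedGaussLaplace]
  rw [← pow_le_pow_iff_left₀ (by positivity) (norm_nonneg _) two_ne_zero]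
  rw [Complex.sq_norm, Complex.normSq_apply, ← sq, ← sq]
  refine le_trans ?_ h
  rw [div_pow, hr, div_le_iff₀ (by positivity)]
  set q := c - x + c * x ^ 2 / 3 - c * x ^ 4 / 10 + 4 * x ^ 5 / 45 with hq
  have e : c * x - x ^ 2 + c * x ^ 3 / 3 - c * x ^ 5 / 10 + 4 * x ^ 6 / 45 = x * q := by
    rw [hq]; ring
  rw [e]
  set Q := 1.2534 - x + 0.4178 * x ^ 2 - 0.1253 * x ^ 4 + 4 / 45 * x ^ 5 with hQ
  have hqQ : q ≤ Q := by
    have a1 : c * x ^ 2 ≤ 1.2534 * x ^ 2 := by gcongr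
    have a2 : 1.2533 * x ^ 4 ≤ c * x ^ 4 := by gcongr
    rw [hq, hQ]
    linarith [pow_nonneg hx 2, pow_nonneg hx 4]
  have hQ0 : 0 ≤ Q := by
    rw [hQ]
    have : x ^ 4 ≤ 1.331 * x := by
      have : x ^ 3 ≤ (11 / 10) ^ 3 := by gcongr
      nlinarith
    have := pow_nonneg hx 5
    nlinarith
  have hs := quintic_mul_sq_le hx h1
  rw [← hQ] at hs
  have hq1 : q * (1 + r * x) ^ 2 ≤ 2.7839 + 2.4672 * x :=
    calc q * (1 + r * x) ^ 2 ≤ Q * (1 + r * x) ^ 2 := by gcongr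
      _ ≤ Q * (1 + 1.7725 * x) ^ 2 := by gcongr
      _ ≤ _ := hs
  have hL : 4 * (2.7839 + 2.4672 * x) ≤ Real.pi * (2 * r + Real.pi * x) := by
    have : 3.1415 * (2 * 1.7724 + 3.1415 * x) ≤ Real.pi * (2 * r + Real.pi * x) := by gcongr
    nlinarith
  have hfin := mul_le_mul_of_nonneg_left (hq1.trans (by linarith :
    2.7839 + 2.4672 * x ≤ Real.pi * (2 * r + Real.pi * x) / 4)) hx
  have e2 : (Real.pi - 4 * (x * q)) * (1 + r * x) ^ 2 =
      Real.pi + x * (Real.pi * (2 * r + r ^ 2 * x)) - 4 * (x * (q * (1 + r * x) ^ 2)) := by ring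
  rw [e2, hr]
  linarith

theorem le_norm_gaussLaplace_ray_of_ge {x : ℝ} (h1 : 11 / 10 ≤ x) :
    Real.sqrt Real.pi / (1 + Real.sqrt Real.pi * x) ≤ ‖gaussLaplace (ray x)‖ := by
  have hx : 0 < x := by linarith
  have h := le_im_rotatedGaussLaplace hx
  obtain ⟨r1, r2⟩ := sqrt_pi_bounds
  rw [← norm_rotatedGaussLaplace]
  refine le_trans (h.trans' ?_) ((le_abs_self _).trans (Complex.abs_im_le_norm _))
  set r := Real.sqrt Real.pi
  rw [div_le_div_iff₀ (by positivity) (by positivity)]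
  have h3 : (11 / 10) ^ 3 ≤ x ^ 3 := by gcongr
  nlinarith

/-- The lower bound that drives the relative error; it is attained at `x = 0`. -/
theorem le_norm_F {x : ℝ} (hx : 0 ≤ x) : 1 / (2 * (1 + Real.sqrt Real.pi * x)) ≤ ‖F x‖ := by
  have h : Real.sqrt Real.pi / (1 + Real.sqrt Real.pi * x) ≤ ‖gaussLaplace (ray x)‖ := by
    rcases le_total x (11 / 10) with h | h
    · exact le_norm_gaussLaplace_ray_of_le hx h
    · exact le_norm_gaussLaplace_ray_of_ge h
  have hp : 0 < Real.sqrt Real.pi := Real.sqrt_pos.2 Real.pi_pos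
  rw [norm_F, le_div_iff₀ (by positivity)]
  refine le_trans (le_of_eq ?_) h
  field_simp

theorem F_ne_zero (x : ℝ) : F x ≠ 0 := by
  rw [← norm_pos_iff]
  rcases le_total 0 x with h | h
  · exact lt_of_lt_of_le (by positivity) (le_norm_F h)
  · exact lt_of_lt_of_le (by norm_num) (half_le_norm_F h)

/-! ### Uniform bounds for `η` -/

theorem β_bounds : 0.05361 ≤ β ∧ β ≤ 0.05362 := by
  have h1 : (1.414213 : ℝ) ≤ Real.sqrt 2 := Real.le_sqrt_of_sq_le (by norm_num)
  have h2 : Real.sqrt 2 ≤ 1.414214 := Real.sqrt_le_iff.2 ⟨by norm_num, by norm_num⟩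
  rw [β]
  constructor <;> linarith

theorem exp_neg_A_sq (N : ℕ) :
    Real.exp (-(A N) ^ 2) = Real.exp (-Real.pi * N) * Real.exp (-(Real.pi / 2)) := by
  rw [A_sq, ← Real.exp_add]
  congr 1
  ring

theorem A_eq_sqrt_pi_mul (N : ℕ) : A N = Real.sqrt Real.pi * Real.sqrt ((N : ℝ) + 1 / 2) := by
  rw [A, mul_comm, Real.sqrt_mul Real.pi_pos.le]

theorem three_halves_pi_le_A_sq {N : ℕ} (hN : 1 ≤ N) : 3 / 2 * Real.pi ≤ A N ^ 2 := by
  rw [A_sq]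
  have : (1 : ℝ) ≤ N := by exact_mod_cast hN
  have := Real.pi_pos
  gcongr
  linarith

/-- The function `a ↦ (1 + κ a) e^{-2 α a}` decreases when `κ ≤ 2 α`. -/
theorem exp_mul_one_add_le {α a κ m : ℝ} (hα : 0 < α) (hm : 0 ≤ m) (h : m ≤ a) (hκ : 0 ≤ κ)
    (hκ' : κ ≤ 2 * α) :
    Real.exp (-(2 * α * a)) * (1 + κ * a) ≤ Real.exp (-(2 * α * m)) * (1 + κ * m) := by
  have v3 : κ * (a - m) ≤ 2 * α * (a - m) := mul_le_mul_of_nonneg_right hκ' (sub_nonneg.2 h)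
  have v4 := Real.add_one_le_exp (2 * α * (a - m))
  have v5 : 0 ≤ κ * m := by positivity
  have v6 : 0 ≤ 2 * α * (a - m) := mul_nonneg (by positivity) (sub_nonneg.2 h)
  have v7 : 1 + κ * a ≤ (1 + κ * m) * Real.exp (2 * α * (a - m)) := by nlinarith
  calc _ ≤ Real.exp (-(2 * α * a)) * ((1 + κ * m) * Real.exp (2 * α * (a - m))) := by gcongr
    _ = _ := by
      rw [mul_left_comm, ← Real.exp_add, mul_comm]
      congr 2
      ring

theorem mul_exp_neg_sq_le_exp_β (α : ℝ) :
    α * Real.exp (-(5 / 2 * α ^ 2)) ≤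
      40 * Real.sqrt 2 / 9 * (Real.exp (-β * α ^ 2) * Real.exp (-α ^ 2)) := by
  have w1 : α ≤ Real.exp (α ^ 2) := by
    have := Real.add_one_le_exp (α ^ 2)
    nlinarith [sq_nonneg (α - 1)]
  have w2 : Real.exp (α ^ 2) * Real.exp (-(5 / 2 * α ^ 2)) ≤
      Real.exp (-β * α ^ 2) * Real.exp (-α ^ 2) := by
    rw [← Real.exp_add, ← Real.exp_add]
    apply Real.exp_le_exp.2
    nlinarith [β_bounds.2, sq_nonneg α]
  have w3 : 1 ≤ 40 * Real.sqrt 2 / 9 := by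
    have : 1 ≤ Real.sqrt 2 := Real.one_le_sqrt.2 (by norm_num)
    linarith
  calc _ ≤ Real.exp (α ^ 2) * Real.exp (-(5 / 2 * α ^ 2)) := by gcongr
    _ ≤ 1 * (Real.exp (-β * α ^ 2) * Real.exp (-α ^ 2)) := by linarith
    _ ≤ _ := by gcongr

/-- The exponential term of `Δ` in its last case is absorbed by the summand `2 √π e^{-β A²}` of the
constant, which belongs to the middle case. -/
theorem exp_div_one_sub_exp_mul_le {α a κ : ℝ} (hα : 0 < α) (hα2 : 3 / 2 * Real.pi ≤ α ^ 2)
    (h : 5 / 4 * α ≤ a) (hκ : 0 ≤ κ) (hκ' : κ ≤ Real.sqrt Real.pi) :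
    Real.exp (-(2 * α * a)) / (1 - Real.exp (-(2 * α * a))) * (1 + κ * (Real.sqrt 2 * a)) ≤
      40 * Real.sqrt 2 / 9 * (Real.exp (-β * α ^ 2) * Real.exp (-α ^ 2) /
        (α * (1 - Real.exp (-2 * α ^ 2))) * (1 + κ * (5 * Real.sqrt 2 / 4 * α))) := by
  have hπ := Real.pi_pos
  have hD : 0 < 1 - Real.exp (-2 * α ^ 2) := by
    have : Real.exp (-2 * α ^ 2) < 1 := Real.exp_lt_one_iff.2 (by nlinarith)
    linarith
  have u2 : 1 - Real.exp (-2 * α ^ 2) ≤ 1 - Real.exp (-(2 * α * a)) := by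
    have : Real.exp (-(2 * α * a)) ≤ Real.exp (-2 * α ^ 2) := Real.exp_le_exp.2 (by nlinarith)
    linarith
  have v0 : κ * Real.sqrt 2 ≤ 2 * α := by
    have v1 : κ * Real.sqrt 2 ≤ Real.sqrt Real.pi * Real.sqrt 2 := by gcongr
    have v2 : Real.sqrt Real.pi * Real.sqrt 2 ≤ 2 * α := by
      rw [← Real.sqrt_mul hπ.le]
      refine Real.sqrt_le_iff.2 ⟨by positivity, ?_⟩
      nlinarith
    exact v1.trans v2
  have u3 := exp_mul_one_add_le hα (by positivity : 0 ≤ 5 / 4 * α) h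
    (by positivity : 0 ≤ κ * Real.sqrt 2) v0
  have u4 := mul_exp_neg_sq_le_exp_β α
  have hp : 0 ≤ (1 + κ * (5 * Real.sqrt 2 / 4 * α)) / (α * (1 - Real.exp (-2 * α ^ 2))) := by
    positivity
  calc _ = Real.exp (-(2 * α * a)) * (1 + κ * Real.sqrt 2 * a) /
        (1 - Real.exp (-(2 * α * a))) := by ring
    _ ≤ Real.exp (-(2 * α * (5 / 4 * α))) * (1 + κ * Real.sqrt 2 * (5 / 4 * α)) /
        (1 - Real.exp (-2 * α ^ 2)) := by
        have : 0 ≤ a := by linarith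
        gcongr
    _ = α * Real.exp (-(5 / 2 * α ^ 2)) * ((1 + κ * (5 * Real.sqrt 2 / 4 * α)) /
        (α * (1 - Real.exp (-2 * α ^ 2)))) := by
      rw [show 2 * α * (5 / 4 * α) = 5 / 2 * α ^ 2 by ring,
        show κ * Real.sqrt 2 * (5 / 4 * α) = κ * (5 * Real.sqrt 2 / 4 * α) by ring]
      generalize 1 + κ * (5 * Real.sqrt 2 / 4 * α) = w
      field_simp
    _ ≤ _ := mul_le_mul_of_nonneg_right u4 hp
    _ = _ := by ring

/-- The worst case of `Δ` is `x / √2 = 5 A / 4`.  The weight `1 + κ x` serves the absolute bound with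
`κ = 0` and the relative bound with `κ = √π`. -/
theorem Δ_mul_le {N : ℕ} (hN : 1 ≤ N) {x κ : ℝ} (hx : 0 ≤ x) (hκ : 0 ≤ κ)
    (hκ' : κ ≤ Real.sqrt Real.pi) :
    Δ N x * (1 + κ * x) ≤
      20 * Real.sqrt 2 * (1 + 2 * Real.sqrt Real.pi * Real.exp (-β * A N ^ 2)) *
        Real.exp (-(A N) ^ 2) / (9 * Real.sqrt Real.pi * A N * (1 - Real.exp (-2 * A N ^ 2))) *
        (1 + κ * (5 * Real.sqrt 2 / 4 * A N)) := by
  have hA := A_pos N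
  have hA2 := three_halves_pi_le_A_sq hN
  have hπ := Real.pi_gt_three
  have hr : 0 < Real.sqrt Real.pi := Real.sqrt_pos.2 Real.pi_pos
  have hs : 0 < Real.sqrt 2 := by positivity
  have hs2 : Real.sqrt 2 ^ 2 = 2 := Real.sq_sqrt (by norm_num)
  have hr2 : Real.sqrt Real.pi ^ 2 = Real.pi := Real.sq_sqrt Real.pi_pos.le
  have hD : 0 < 1 - Real.exp (-2 * A N ^ 2) := by linarith [exp_neg_two_A_sq_lt_one N]
  have hE := Real.exp_pos (-(A N) ^ 2)
  have hb := Real.exp_pos (-β * A N ^ 2)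
  have hB : 1 ≤ 1 + 2 * Real.sqrt Real.pi * Real.exp (-β * A N ^ 2) := by
    have : 0 ≤ 2 * Real.sqrt Real.pi * Real.exp (-β * A N ^ 2) := by positivity
    linarith
  obtain ⟨a, rfl⟩ : ∃ a, x = Real.sqrt 2 * a := ⟨x / Real.sqrt 2, by field_simp⟩
  have ha : 0 ≤ a := nonneg_of_mul_nonneg_right hx hs
  have e1 : Real.sqrt 2 * a / Real.sqrt 2 = a := by field_simp
  have e2 : (Real.sqrt 2 * a) ^ 2 / 2 = a ^ 2 := by rw [mul_pow, hs2]; ring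
  rw [Δ, e1, e2]
  set s := Real.sqrt 2
  set r := Real.sqrt Real.pi
  set D := 1 - Real.exp (-2 * A N ^ 2) with hDdef
  set E := Real.exp (-(A N) ^ 2) with hEdef
  set b := Real.exp (-β * A N ^ 2) with hbdef
  set α := A N
  split_ifs with h1 h2
  · have hd : 7 / 16 * α ^ 2 ≤ α ^ 2 - a ^ 2 := by nlinarith
    have hw : 1 + κ * (s * a) ≤ 1 + κ * (5 * s / 4 * α) := by
      have : s * a ≤ 5 * s / 4 * α := by nlinarith
      gcongr
    refine mul_le_mul ?_ hw (by positivity) (by positivity)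
    calc s * a * E / (r * (α ^ 2 - a ^ 2) * D) ≤
          s * (3 / 4 * α) * E / (r * (7 / 16 * α ^ 2) * D) := by gcongr
      _ = 12 / 7 * (s * 1 * E / (r * α * D)) := by field_simp; ring
      _ ≤ 20 / 9 * (s * 1 * E / (r * α * D)) :=
        mul_le_mul_of_nonneg_right (by norm_num) (by positivity)
      _ ≤ 20 / 9 * (s * (1 + 2 * r * b) * E / (r * α * D)) := by gcongr
      _ = _ := by field_simp
  · have hw : 1 + κ * (s * a) ≤ 1 + κ * (5 * s / 4 * α) := by
      have : s * a ≤ 5 * s / 4 * α := by nlinarith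
      gcongr
    refine mul_le_mul ?_ hw (by positivity) (by positivity)
    have h3 : a / (α + a) ≤ 5 / 9 := by
      rw [div_le_div_iff₀ (by positivity) (by norm_num)]; linarith
    calc 4 * (s * a) * E * (1 + 2 * r * b) / (r * α * (α + a) * D) =
          4 * s * E * (1 + 2 * r * b) / (r * α * D) * (a / (α + a)) := by field_simp
      _ ≤ 4 * s * E * (1 + 2 * r * b) / (r * α * D) * (5 / 9) := by gcongr
      _ = _ := by field_simp; ring
  · rw [not_lt] at h2
    have ha0 : 0 < a := by linarith
    have hd : 9 / 25 * a ^ 2 ≤ a ^ 2 - α ^ 2 := by nlinarith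
    have hR : 20 * s * (1 + 2 * r * b) * E / (9 * r * α * D) * (1 + κ * (5 * s / 4 * α)) =
        E / (r * D) * (20 * s / (9 * α) + 50 / 9 * κ) +
        40 * s / 9 * (b * E / (α * D) * (1 + κ * (5 * s / 4 * α))) := by
      field_simp
      linear_combination 100 * α * κ * hs2
    have t1 : s * a * E / (r * (a ^ 2 - α ^ 2) * D) * (1 + κ * (s * a)) ≤
        E / (r * D) * (20 * s / (9 * α) + 50 / 9 * κ) := by
      calc s * a * E / (r * (a ^ 2 - α ^ 2) * D) * (1 + κ * (s * a)) ≤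
          s * a * E / (r * (9 / 25 * a ^ 2) * D) * (1 + κ * (s * a)) := by gcongr
        _ = E / (r * D) * (25 / 9 * s / a + 50 / 9 * κ) := by
          field_simp
          linear_combination 25 * a * κ * hs2
        _ ≤ E / (r * D) * (25 / 9 * s / (5 / 4 * α) + 50 / 9 * κ) := by gcongr
        _ = _ := by field_simp; ring
    have t2 : Real.exp (-(s * α * (s * a))) / (1 - Real.exp (-(s * α * (s * a)))) *
        (1 + κ * (s * a)) ≤ 40 * s / 9 * (b * E / (α * D) * (1 + κ * (5 * s / 4 * α))) := by
      rw [show s * α * (s * a) = 2 * α * a by linear_combination α * a * hs2]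
      exact exp_div_one_sub_exp_mul_le hA hA2 h2 hκ hκ'
    rw [hR, add_mul]
    exact add_le_add t1 t2

/-- The weighted bound for `η`; the values of the right-hand side at `κ = 0` and `κ = √π` give `c` and
`cStar`. -/
theorem η_mul_le {N : ℕ} (hN : 1 ≤ N) (x : ℝ) {κ : ℝ} (hκ : 0 ≤ κ)
    (hκ' : κ ≤ Real.sqrt Real.pi) :
    η N x * (1 + κ * |x|) ≤
      20 * Real.sqrt 2 * (1 + 2 * Real.sqrt Real.pi * Real.exp (-β * A N ^ 2)) *
        Real.exp (-(A N) ^ 2) / (9 * Real.sqrt Real.pi * A N * (1 - Real.exp (-2 * A N ^ 2))) *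
        (1 + κ * (5 * Real.sqrt 2 / 4 * A N)) +
      (2 * Real.pi + 1) / (2 * Real.pi * A N) * Real.exp (-(A N) ^ 2) *
        (1 / (Real.sqrt 2 * A N) + κ) := by
  have hA := A_pos N
  have hπ := Real.pi_pos
  have hs2 : Real.sqrt 2 ^ 2 = 2 := Real.sq_sqrt (by norm_num)
  have h1 := Δ_mul_le hN (abs_nonneg x) hκ hκ'
  have hx4 : x ^ 4 = |x| ^ 4 := (Even.pow_abs (by decide) x).symm
  rw [η, hx4, add_mul]
  refine add_le_add h1 ?_
  generalize hy : |x| = y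
  have hy0 : 0 ≤ y := hy ▸ abs_nonneg x
  set q := Real.sqrt (y ^ 4 + A N ^ 4) with hq
  have hq0 : 0 < q := by positivity
  have h2 : y / q ≤ 1 / (Real.sqrt 2 * A N) := by
    rw [div_le_div_iff₀ hq0 (by positivity), one_mul]
    apply Real.le_sqrt_of_sq_le
    rw [mul_pow, mul_pow, hs2]
    nlinarith [sq_nonneg (y ^ 2 - A N ^ 2)]
  have h3 : y ^ 2 / q ≤ 1 := by
    rw [div_le_one hq0]
    apply Real.le_sqrt_of_sq_le
    nlinarith [pow_pos hA 4]
  calc _ = (2 * Real.pi + 1) / (2 * Real.pi * A N) * Real.exp (-(A N) ^ 2) *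
        (y / q + κ * (y ^ 2 / q)) := by field_simp
    _ ≤ (2 * Real.pi + 1) / (2 * Real.pi * A N) * Real.exp (-(A N) ^ 2) *
        (1 / (Real.sqrt 2 * A N) + κ * 1) := by gcongr
    _ = _ := by rw [mul_one]

theorem one_sub_exp_pos (N : ℕ) : 0 < 1 - Real.exp (-2 * A N ^ 2) := by
  linarith [exp_neg_two_A_sq_lt_one N]

theorem η_nonneg (N : ℕ) (x : ℝ) : 0 ≤ η N x :=
  (norm_nonneg _).trans (norm_F_sub_approxF_le N x)

theorem η_le {N : ℕ} (hN : 1 ≤ N) (x : ℝ) :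
    η N x ≤ c N * (Real.exp (-Real.pi * N) / Real.sqrt ((N : ℝ) + 1 / 2)) := by
  have h := η_mul_le hN x le_rfl (Real.sqrt_nonneg _)
  rw [zero_mul, add_zero, mul_one, zero_mul, add_zero, mul_one, add_zero] at h
  refine h.trans (le_of_eq ?_)
  have hD := one_sub_exp_pos N
  have hr : 0 < Real.sqrt Real.pi := Real.sqrt_pos.2 Real.pi_pos
  have hr2 : Real.sqrt Real.pi ^ 2 = Real.pi := Real.sq_sqrt Real.pi_pos.le
  have hn : 0 < Real.sqrt ((N : ℝ) + 1 / 2) := by positivity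
  have hπ := Real.pi_pos
  have h32 : Real.pi ^ (3 / 2 : ℝ) = Real.sqrt Real.pi ^ 3 := by
    rw [Real.sqrt_eq_rpow, ← Real.rpow_natCast, ← Real.rpow_mul hπ.le]
    norm_num
  rw [c, exp_neg_A_sq, h32]
  generalize 1 - Real.exp (-2 * A N ^ 2) = D at *
  generalize Real.exp (-β * A N ^ 2) = b
  generalize Real.exp (-(Real.pi / 2)) = p
  generalize Real.exp (-Real.pi * N) = P
  rw [A_eq_sqrt_pi_mul]
  generalize Real.sqrt ((N : ℝ) + 1 / 2) = n at *
  generalize Real.sqrt Real.pi = r at *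
  rw [← hr2]
  field_simp

theorem η_mul_le_cStar {N : ℕ} (hN : 1 ≤ N) (x : ℝ) :
    η N x * (2 * (1 + Real.sqrt Real.pi * |x|)) ≤ cStar N * Real.exp (-Real.pi * N) := by
  have h := η_mul_le hN x (Real.sqrt_nonneg _) le_rfl
  have hD := one_sub_exp_pos N
  have hA := A_pos N
  have hr : 0 < Real.sqrt Real.pi := Real.sqrt_pos.2 Real.pi_pos
  have hπ := Real.pi_pos
  have e : cStar N * Real.exp (-Real.pi * N) = 2 *
      (20 * Real.sqrt 2 * (1 + 2 * Real.sqrt Real.pi * Real.exp (-β * A N ^ 2)) *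
        Real.exp (-(A N) ^ 2) / (9 * Real.sqrt Real.pi * A N * (1 - Real.exp (-2 * A N ^ 2))) *
        (1 + Real.sqrt Real.pi * (5 * Real.sqrt 2 / 4 * A N)) +
      (2 * Real.pi + 1) / (2 * Real.pi * A N) * Real.exp (-(A N) ^ 2) *
        (1 / (Real.sqrt 2 * A N) + Real.sqrt Real.pi)) := by
    rw [cStar, exp_neg_A_sq, Real.exp_neg (Real.pi / 2), Real.sqrt_mul (by norm_num) Real.pi]
    have := Real.exp_pos (Real.pi / 2)
    generalize 1 - Real.exp (-2 * A N ^ 2) = D at *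
    generalize Real.exp (-β * A N ^ 2) = b
    generalize Real.exp (Real.pi / 2) = p at *
    generalize Real.exp (-Real.pi * N) = P
    generalize Real.sqrt Real.pi = r at *
    field_simp
    ring
  rw [e]
  linarith

theorem η_div_norm_F_le_of_nonneg {N : ℕ} (hN : 1 ≤ N) {x : ℝ} (hx : 0 ≤ x) :
    η N x / ‖F x‖ ≤ cStar N * Real.exp (-Real.pi * N) := by
  have h1 := le_norm_F hx
  have h2 := η_mul_le_cStar hN x
  rw [abs_of_nonneg hx] at h2
  refine le_trans ?_ h2
  have h3 : 0 < 2 * (1 + Real.sqrt Real.pi * x) := by positivity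
  have h4 := η_nonneg N x
  calc η N x / ‖F x‖ ≤ η N x / (1 / (2 * (1 + Real.sqrt Real.pi * x))) := by gcongr
    _ = _ := by rw [div_div_eq_mul_div, div_one]

theorem η_div_norm_F_le_of_nonpos {N : ℕ} (hN : 1 ≤ N) {x : ℝ} (hx : x ≤ 0) :
    η N x / ‖F x‖ ≤ 2 * c N * (Real.exp (-Real.pi * N) / Real.sqrt ((N : ℝ) + 1 / 2)) := by
  have h1 := half_le_norm_F hx
  have h2 := η_le hN x
  have h4 := η_nonneg N x
  calc η N x / ‖F x‖ ≤ η N x / (1 / 2) := by gcongr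
    _ ≤ _ := by linarith

/-! ### The constant `cStar` -/

/-- A form of `cStar` in which every factor that depends on `N` is visibly decreasing. -/
theorem cStar_eq (N : ℕ) : cStar N =
    10 * Real.sqrt 2 / (9 * Real.sqrt Real.pi * Real.exp (Real.pi / 2)) *
      (4 / A N + 5 * Real.sqrt (2 * Real.pi)) *
      (1 + 2 * Real.sqrt Real.pi * Real.exp (-β * A N ^ 2)) / (1 - Real.exp (-2 * A N ^ 2)) +
    (2 * Real.pi + 1) / (Real.pi * Real.exp (Real.pi / 2)) *
      (1 / (Real.sqrt 2 * A N ^ 2) + Real.sqrt Real.pi / A N) := by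
  have hA := A_pos N
  have hD := one_sub_exp_pos N
  have hr : 0 < Real.sqrt Real.pi := Real.sqrt_pos.2 Real.pi_pos
  have hp := Real.exp_pos (Real.pi / 2)
  have hπ := Real.pi_pos
  rw [cStar]
  generalize Real.exp (Real.pi / 2) = p at *
  generalize 1 - Real.exp (-2 * A N ^ 2) = D at *
  generalize 1 + 2 * Real.sqrt Real.pi * Real.exp (-β * A N ^ 2) = B
  generalize Real.sqrt (2 * Real.pi) = r2
  field_simp

theorem cStar_strictAnti {M N : ℕ} (h : M < N) : cStar N < cStar M := by
  have hM := A_pos M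
  have hMN : A M < A N := by
    have h' : (M : ℝ) < N := by exact_mod_cast h
    have hπ := Real.pi_pos
    exact Real.sqrt_lt_sqrt (by positivity) (by gcongr)
  have hN := A_pos N
  have hD := one_sub_exp_pos M
  have hD' := one_sub_exp_pos N
  have hβ := β_bounds.1
  have hr : 0 < Real.sqrt Real.pi := Real.sqrt_pos.2 Real.pi_pos
  have hπ := Real.pi_pos
  have hsq : A M ^ 2 < A N ^ 2 := by gcongr
  have e1 : Real.exp (-β * A N ^ 2) ≤ Real.exp (-β * A M ^ 2) :=
    Real.exp_le_exp.2 (by nlinarith)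
  have e2 : Real.exp (-2 * A N ^ 2) ≤ Real.exp (-2 * A M ^ 2) :=
    Real.exp_le_exp.2 (by nlinarith)
  rw [cStar_eq, cStar_eq]
  refine add_lt_add_of_le_of_lt ?_ ?_
  · gcongr
  · gcongr

theorem tendsto_A : Tendsto A atTop atTop := by
  have h : Tendsto (fun N : ℕ => ((N : ℝ) + 1 / 2) * Real.pi) atTop atTop :=
    (tendsto_atTop_add_const_right _ _ tendsto_natCast_atTop_atTop).atTop_mul_const Real.pi_pos
  exact Real.tendsto_sqrt_atTop.comp h

theorem tendsto_exp_neg_mul_A_sq {b : ℝ} (hb : 0 < b) :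
    Tendsto (fun N => Real.exp (-b * A N ^ 2)) atTop (𝓝 0) := by
  have h : Tendsto (fun N => A N ^ 2) atTop atTop :=
    (tendsto_pow_atTop two_ne_zero).comp tendsto_A
  exact Real.tendsto_exp_atBot.comp (h.const_mul_atTop_of_neg (by linarith))

theorem tendsto_cStar : Tendsto cStar atTop (𝓝 (100 * Real.exp (-(Real.pi / 2)) / 9)) := by
  have hβ : 0 < β := by linarith [β_bounds.1]
  have hr : 0 < Real.sqrt Real.pi := Real.sqrt_pos.2 Real.pi_pos
  have hinv : Tendsto (fun N => (A N)⁻¹) atTop (𝓝 0) := tendsto_inv_atTop_zero.comp tendsto_A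
  have h1 : Tendsto (fun N => 4 / A N + 5 * Real.sqrt (2 * Real.pi)) atTop
      (𝓝 (4 * 0 + 5 * Real.sqrt (2 * Real.pi))) := by
    simpa only [div_eq_mul_inv] using (hinv.const_mul 4).add_const _
  have h2 := ((tendsto_exp_neg_mul_A_sq hβ).const_mul (2 * Real.sqrt Real.pi)).const_add 1
  have h3 := (tendsto_exp_neg_mul_A_sq (b := 2) two_pos).const_sub 1
  have h4 : Tendsto (fun N => 1 / (Real.sqrt 2 * A N ^ 2) + Real.sqrt Real.pi / A N) atTop
      (𝓝 (1 / Real.sqrt 2 * 0 ^ 2 + Real.sqrt Real.pi * 0)) := by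
    refine (((hinv.pow 2).const_mul (1 / Real.sqrt 2)).add
      (hinv.const_mul (Real.sqrt Real.pi))).congr fun N => ?_
    field_simp
  have h := (((h1.const_mul (10 * Real.sqrt 2 /
    (9 * Real.sqrt Real.pi * Real.exp (Real.pi / 2)))).mul h2).div h3 (by norm_num)).add
    (h4.const_mul ((2 * Real.pi + 1) / (Real.pi * Real.exp (Real.pi / 2))))
  have e : 10 * Real.sqrt 2 / (9 * Real.sqrt Real.pi * Real.exp (Real.pi / 2)) *
      (4 * 0 + 5 * Real.sqrt (2 * Real.pi)) * (1 + 2 * Real.sqrt Real.pi * 0) / (1 - 0) +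
      (2 * Real.pi + 1) / (Real.pi * Real.exp (Real.pi / 2)) *
        (1 / Real.sqrt 2 * 0 ^ 2 + Real.sqrt Real.pi * 0) =
      100 * Real.exp (-(Real.pi / 2)) / 9 := by
    have hs2 : Real.sqrt 2 ^ 2 = 2 := Real.sq_sqrt (by norm_num)
    have hp := Real.exp_pos (Real.pi / 2)
    rw [Real.sqrt_mul (by norm_num) Real.pi, Real.exp_neg]
    simp only [mul_zero, zero_add, add_zero, sub_zero, mul_one, div_one, ne_eq, OfNat.ofNat_ne_zero,
      not_false_eq_true, zero_pow]
    field_simp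
    linear_combination 50 * hs2
  rw [← e]
  exact h.congr fun N => (cStar_eq N).symm

/-- Taylor bounds of degree `5` on `[0, 1]`. -/
theorem exp_bounds_of_taylor {x l u : ℝ} (h0 : 0 ≤ x) (h1 : x ≤ 1)
    (hl : l ≤ 1 + x + x ^ 2 / 2 + x ^ 3 / 6 + x ^ 4 / 24 + x ^ 5 / 120)
    (hu : 1 + x + x ^ 2 / 2 + x ^ 3 / 6 + x ^ 4 / 24 + x ^ 5 / 120 + x ^ 6 * 7 / 4320 ≤ u) :
    l ≤ Real.exp x ∧ Real.exp x ≤ u := by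
  have a := Real.sum_le_exp_of_nonneg h0 6
  have b := Real.exp_bound' h0 h1 (n := 6) (by norm_num)
  simp [Finset.sum_range_succ, Nat.factorial] at a b
  norm_num at a b
  constructor <;> linarith

theorem exp_half_pi_bounds : 4.810 ≤ Real.exp (Real.pi / 2) ∧ Real.exp (Real.pi / 2) ≤ 4.811 := by
  have h1 := Real.pi_gt_d6
  have h2 := Real.pi_lt_d6
  -- The Taylor bounds are applied at `π / 8`, which lies in `[0, 1]`.
  have hl : Real.exp 0.392699 ^ 4 ≤ Real.exp (Real.pi / 2) := by
    rw [← Real.exp_nat_mul]; exact Real.exp_le_exp.2 (by norm_num; linarith)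
  have hu : Real.exp (Real.pi / 2) ≤ Real.exp 0.3927 ^ 4 := by
    rw [← Real.exp_nat_mul]; exact Real.exp_le_exp.2 (by norm_num; linarith)
  have b1 := (exp_bounds_of_taylor (x := 0.392699) (l := 1.48096) (u := 2) (by norm_num) (by norm_num)
    (by norm_num) (by norm_num)).1
  have b2 := (exp_bounds_of_taylor (x := 0.3927) (l := 1) (u := 1.481) (by norm_num) (by norm_num)
    (by norm_num) (by norm_num)).2
  constructor
  · refine le_trans ?_ hl
    calc (4.810 : ℝ) ≤ 1.48096 ^ 4 := by norm_num
      _ ≤ _ := by gcongr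
  · refine hu.trans ?_
    calc Real.exp 0.3927 ^ 4 ≤ 1.481 ^ 4 := by gcongr
      _ ≤ 4.811 := by norm_num

theorem abs_limit_sub_lt : |100 * Real.exp (-(Real.pi / 2)) / 9 - 2.3| < 0.05 := by
  obtain ⟨h1, h2⟩ := exp_half_pi_bounds
  rw [Real.exp_neg]
  have h3 : (Real.exp (Real.pi / 2))⁻¹ ≤ 4.810⁻¹ := by gcongr
  have h4 : 4.811⁻¹ ≤ (Real.exp (Real.pi / 2))⁻¹ := by gcongr
  norm_num at h3 h4
  rw [abs_lt]
  constructor <;> norm_num <;> linarith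

theorem A_one_bounds : 2.1708 ≤ A 1 ∧ A 1 ≤ 2.1709 := by
  have h1 := Real.pi_gt_d6
  have h2 := Real.pi_lt_d6
  rw [A]
  constructor
  · apply Real.le_sqrt_of_sq_le
    push_cast
    linarith
  · refine Real.sqrt_le_iff.2 ⟨by norm_num, ?_⟩
    push_cast
    linarith

theorem A_one_sq : A 1 ^ 2 = 3 / 2 * Real.pi := by
  rw [A_sq]; norm_num

theorem exp_neg_β_bounds : 0.776 ≤ Real.exp (-β * A 1 ^ 2) ∧ Real.exp (-β * A 1 ^ 2) ≤ 0.777 := by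
  have h1 := Real.pi_gt_d6
  have h2 := Real.pi_lt_d6
  obtain ⟨b1, b2⟩ := β_bounds
  rw [A_one_sq, neg_mul, Real.exp_neg]
  have hl : Real.exp 0.2526 ≤ Real.exp (β * (3 / 2 * Real.pi)) :=
    Real.exp_le_exp.2 (by nlinarith)
  have hu : Real.exp (β * (3 / 2 * Real.pi)) ≤ Real.exp 0.2527 :=
    Real.exp_le_exp.2 (by nlinarith)
  have c1 := (exp_bounds_of_taylor (x := 0.2526) (l := 1.2873) (u := 2) (by norm_num) (by norm_num)
    (by norm_num) (by norm_num)).1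
  have c2 := (exp_bounds_of_taylor (x := 0.2527) (l := 1) (u := 1.2876) (by norm_num) (by norm_num)
    (by norm_num) (by norm_num)).2
  have d1 : (1.2873 : ℝ) ≤ Real.exp (β * (3 / 2 * Real.pi)) := c1.trans hl
  have d2 : Real.exp (β * (3 / 2 * Real.pi)) ≤ 1.2876 := hu.trans c2
  constructor
  · calc (0.776 : ℝ) ≤ 1.2876⁻¹ := by norm_num
      _ ≤ _ := by gcongr
  · calc (Real.exp (β * (3 / 2 * Real.pi)))⁻¹ ≤ 1.2873⁻¹ := by gcongr
      _ ≤ 0.777 := by norm_num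

theorem exp_neg_two_A_one_sq_le : Real.exp (-2 * A 1 ^ 2) ≤ 0.0002 := by
  have h1 := Real.pi_gt_d6
  rw [A_one_sq, neg_mul, Real.exp_neg]
  have h2 : (2.7 : ℝ) ^ 9 ≤ Real.exp (2 * (3 / 2 * Real.pi)) := by
    calc (2.7 : ℝ) ^ 9 ≤ Real.exp 1 ^ 9 := by
          have := Real.exp_one_gt_d9
          gcongr
          linarith
      _ = Real.exp 9 := by rw [← Real.exp_nat_mul]; norm_num
      _ ≤ _ := Real.exp_le_exp.2 (by linarith)
  calc _ ≤ ((2.7 : ℝ) ^ 9)⁻¹ := by gcongr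
    _ ≤ _ := by norm_num

theorem abs_cStar_one_sub_lt : |cStar 1 - 10.4| < 0.05 := by
  have hπ1 := Real.pi_gt_d6
  have hπ2 := Real.pi_lt_d6
  obtain ⟨p1, p2⟩ := exp_half_pi_bounds
  obtain ⟨a1, a2⟩ := A_one_bounds
  obtain ⟨b1, b2⟩ := exp_neg_β_bounds
  have d1 := exp_neg_two_A_one_sq_le
  have d2 := Real.exp_pos (-2 * A 1 ^ 2)
  have s1 : (1.414213 : ℝ) ≤ Real.sqrt 2 := Real.le_sqrt_of_sq_le (by norm_num)
  have s2 : Real.sqrt 2 ≤ 1.414214 := Real.sqrt_le_iff.2 ⟨by norm_num, by norm_num⟩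
  have r1 : 1.77245 ≤ Real.sqrt Real.pi := Real.le_sqrt_of_sq_le (by linarith)
  have r2 : Real.sqrt Real.pi ≤ 1.77246 := Real.sqrt_le_iff.2 ⟨by norm_num, by linarith⟩
  have hs2 : Real.sqrt 2 ^ 2 = 2 := Real.sq_sqrt (by norm_num)
  have e : cStar 1 = (40 * Real.sqrt 2 / (9 * (Real.sqrt Real.pi * A 1)) + 100 / 9) *
      (1 + 2 * Real.sqrt Real.pi * Real.exp (-β * A 1 ^ 2)) /
      (Real.exp (Real.pi / 2) * (1 - Real.exp (-2 * A 1 ^ 2))) +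
      (2 + 1 / Real.pi) / Real.exp (Real.pi / 2) *
      (1 / (Real.sqrt 2 * A 1 ^ 2) + Real.sqrt Real.pi / A 1) := by
    have hA := A_pos 1
    have hD := one_sub_exp_pos 1
    rw [cStar_eq, Real.sqrt_mul (by norm_num) Real.pi]
    generalize Real.exp (-β * A 1 ^ 2) = b at *
    generalize 1 - Real.exp (-2 * A 1 ^ 2) = D at *
    generalize Real.exp (Real.pi / 2) = p at *
    have hp : 0 < p := by linarith
    have hr : 0 < Real.sqrt Real.pi := by linarith
    have f1 : 10 * Real.sqrt 2 / (9 * Real.sqrt Real.pi * p) *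
        (4 / A 1 + 5 * (Real.sqrt 2 * Real.sqrt Real.pi)) =
        (40 * Real.sqrt 2 / (9 * (Real.sqrt Real.pi * A 1)) + 100 / 9) / p := by
      generalize Real.sqrt Real.pi = r at *
      field_simp
      linear_combination 50 * r * A 1 * hs2
    have f2 : (2 * Real.pi + 1) / (Real.pi * p) = (2 + 1 / Real.pi) / p := by
      have : Real.pi ≠ 0 := Real.pi_ne_zero
      field_simp
    rw [f1, f2]
    ring
  rw [e]
  generalize Real.exp (-β * A 1 ^ 2) = b at *
  generalize Real.exp (-2 * A 1 ^ 2) = D at *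
  generalize Real.exp (Real.pi / 2) = p at *
  generalize Real.sqrt Real.pi = r at *
  generalize Real.sqrt 2 = s at *
  generalize A 1 = α at *
  generalize Real.pi = π at *
  have D1 : 1 - 0.0002 ≤ 1 - D := by linarith
  have D2 : 1 - D ≤ 1 := by linarith
  rw [abs_lt]
  constructor
  · have : (40 * 1.414213 / (9 * (1.77246 * 2.1709)) + 100 / 9) * (1 + 2 * 1.77245 * 0.776) /
        (4.811 * 1) + (2 + 1 / 3.141593) / 4.811 *
        (1 / (1.414214 * 2.1709 ^ 2) + 1.77245 / 2.1709) ≤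
        (40 * s / (9 * (r * α)) + 100 / 9) * (1 + 2 * r * b) / (p * (1 - D)) +
        (2 + 1 / π) / p * (1 / (s * α ^ 2) + r / α) := by
      gcongr
    norm_num at this ⊢
    linarith
  · have : (40 * s / (9 * (r * α)) + 100 / 9) * (1 + 2 * r * b) / (p * (1 - D)) +
        (2 + 1 / π) / p * (1 / (s * α ^ 2) + r / α) ≤
        (40 * 1.414214 / (9 * (1.77245 * 2.1708)) + 100 / 9) * (1 + 2 * 1.77246 * 0.777) /
        (4.810 * (1 - 0.0002)) + (2 + 1 / 3.141592) / 4.810 *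
        (1 / (1.414213 * 2.1708 ^ 2) + 1.77246 / 2.1708) := by
      gcongr
    norm_num at this ⊢
    linarith

end FresnelTrap

theorem theorem5 :
    -- the improper integral that defines `F` converges, and `F` has no real zero,
    -- so that the relative error makes sense
    (∀ x : ℝ, Tendsto (fun T : ℝ => FresnelTrap.truncF x T) atTop (𝓝 (FresnelTrap.F x))) ∧
    (∀ x : ℝ, FresnelTrap.F x ≠ 0) ∧
    -- the error bounds
    (∀ N : ℕ, 1 ≤ N → ∀ x : ℝ,
      ‖FresnelTrap.F x - FresnelTrap.approxF N x‖ / ‖FresnelTrap.F x‖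
          ≤ FresnelTrap.η N x / ‖FresnelTrap.F x‖ ∧
      (0 ≤ x → FresnelTrap.η N x / ‖FresnelTrap.F x‖
          ≤ FresnelTrap.cStar N * Real.exp (-Real.pi * N)) ∧
      (x ≤ 0 → FresnelTrap.η N x / ‖FresnelTrap.F x‖
          ≤ 2 * FresnelTrap.c N * (Real.exp (-Real.pi * N) / Real.sqrt ((N : ℝ) + 1 / 2)))) ∧
    -- the behaviour of `c_N^*`
    (∀ M N : ℕ, 1 ≤ M → M < N → FresnelTrap.cStar N < FresnelTrap.cStar M) ∧
    |FresnelTrap.cStar 1 - 10.4| < 0.05 ∧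
    Tendsto FresnelTrap.cStar atTop (𝓝 (100 * Real.exp (-(Real.pi / 2)) / 9)) ∧
    |100 * Real.exp (-(Real.pi / 2)) / 9 - 2.3| < 0.05 := by
  refine ⟨FresnelTrap.tendsto_truncF_F, FresnelTrap.F_ne_zero, fun N hN x => ⟨?_, ?_, ?_⟩,
    fun M N _ h => FresnelTrap.cStar_strictAnti h, FresnelTrap.abs_cStar_one_sub_lt,
    FresnelTrap.tendsto_cStar, FresnelTrap.abs_limit_sub_lt⟩
  · have := FresnelTrap.norm_F_sub_approxF_le N x
    gcongr
  · exact FresnelTrap.η_div_norm_F_le_of_nonneg hN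
  · exact FresnelTrap.η_div_norm_F_le_of_nonpos hN
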